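/- **Model.** The Earth is a sphere of radius $R_\oplus>0$ centred at the origin. There are $K$ tiers of satellites, tier $k$ consisting of $N_k\ge 1$ satellites at altitude $a_k>0$, and $R_k=a_k+R_\oplus$. Fix the legitimate tier $m$. The $N_m$ satellites of tier $m$ are i.i.d. uniform on the sphere of radius $R_m$. The typical device sits at $(0,0,R_\oplus)$; the other devices form a homogeneous Poisson point process with density $\lambda_u>0$ per unit of area on the sphere of radius $R_\oplus$. Let $\theta_{\rm beam}>0$ be the half beamwidth and $$\theta_{m,\max}=\begin{cases}\sin^{-1}\!\big(\tfrac{R_m}{R_\oplus}\sin\theta_{\rm beam}\big)-\theta_{\rm beam}, & \theta_{\rm beam}<\sin^{-1}(R_\oplus/R_m),\\ \cos^{-1}(R_\oplus/R_m), & \text{otherwise.}\end{cases}$$ A satellite of tier $m$ receives from a device at distance $d$, seen at central angle $\theta$, the power $P_{\rm rec}=P_t\big(\frac{c}{4\pi f d}\big)^2G\,|h|^2$ if $\theta<\theta_{m,\max}$, and $0$ otherwise (the device is then outside the main lobe or the line of sight); here $P_t,G,c,f>0$, and $|h|^2$ is the small-scale fading power of the link. The fading powers on the links from the devices to the serving satellite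 are independent; those of the interfering devices are Gamma distributed with integer shape $m_1\ge1$ and scale $m_2>0$, and that of the typical device has an arbitrary law with distribution function $F$. Satellites, devices and fading are mutually independent. The typical device is served by its nearest satellite of tier $m$, with $$\mathrm{SINR}_{\rm LS}=\frac{\gamma P_{{\rm rec},0}}{\mathcal I_m+\sigma_S^2},$$ where $\gamma\in(0,1]$ is the information-bearing ratio, $P_{{\rm rec},0}$ is the power received from the typical device, $\mathcal I_m$ is the sum of the powers received from all other devices, and $\sigma_S^2=N_0B>0$. For $\beta_{\rm LS}>0$ let $\mathcal P_{m,\rm cov}=\mathbb P[\mathrm{SINR}_{\rm LS}>\beta_{\rm LS}]$. **Notation.** Put $d(\theta)=\sqrt{R_\oplus^2+R_m^2-2R_\oplus R_m\cos\theta}$, $$f_{\theta_{m,0}}(\theta)=\tfrac{N_m\sin\theta}{2}\Big(\tfrac{1+\cos\theta}{2}\Big)^{N_m-1},\qquad \mathcal P_{m,\rm av}=1-\Big(\tfrac{1+\cos\theta_{m,\max}}{2}\Big)^{N_m},$$ $$\mathcal L_{\mathcal I_m}(s)=\exp\Big(-\lambda_u\int_0^{2\pi}\!\!\int_0^{\theta_{m,\max}}\Big[1-\Big(1+m_2sP_tG\big(\tfrac{c}{4\pi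 f d(\theta)}\big)^2\Big)^{-m_1}\Big]R_\oplus^2\sin\theta\,d\theta\,d\varphi\Big),$$ $$\kappa=\frac{(m_1!)^{-1/m_1}}{m_2},\qquad s_{\rm LS}(\theta)=\kappa\,\frac{\beta_{\rm LS}}{\gamma P_tG}\Big(\frac{4\pi f\,d(\theta)}{c}\Big)^2,\qquad A(x)=\big[1-e^{-\kappa x}\big]^{m_1},$$ $$Q=\sum_{q=1}^{m_1}\binom{m_1}{q}(-1)^{q+1}\int_0^{\theta_{m,\max}}\exp\!\big(-q\,s_{\rm LS}(\theta)\sigma_S^2\big)\,\mathcal L_{\mathcal I_m}\!\big(q\,s_{\rm LS}(\theta)\big)\,f_{\theta_{m,0}}(\theta)\,d\theta.$$ **Claim (coverage probability under the approximation $F\approx A$ of the fading distribution).** 1. If $F(x)=A(x)$ for all $x\ge0$, then $\mathcal P_{m,\rm cov}=Q$. 2. If $|F(x)-A(x)|\le\varepsilon$ for all $x\ge0$, then $|\mathcal P_{m,\rm cov}-Q|\le\varepsilon\,\mathcal P_{m,\rm av}$. 3. If $F\le A$ on $[0,\infty)$, then $\mathcal P_{m,\rm cov}\ge Q$; if $F\ge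 A$ on $[0,\infty)$, then $\mathcal P_{m,\rm cov}\le Q$. 4. If $m_1=1$ and the fading of the typical device is also Gamma with shape $m_1$ and scale $m_2$, then $\mathcal P_{m,\rm cov}=Q$. -/

import Mathlib

open MeasureTheory ProbabilityTheory

namespace LEOUplink

noncomputable section

/-- Physical space, with the centre of the Earth at the origin. -/
abbrev Space : Type := EuclideanSpace ℝ (Fin 3)

/-- The surface area measure of the sphere of radius `R` about the origin, as a measure on space
(the surface measure of the unit sphere, pushed forward by the dilation and scaled by `R ^ 2`). -/
def sphereArea (R : ℝ) : Measure Space :=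
  ENNReal.ofReal (R ^ 2) •
    ((volume : Measure Space).toSphere).map
      (fun n : Metric.sphere (0 : Space) 1 => R • (n : Space))

/-- The uniform probability distribution on the sphere of radius `R` about the origin. -/
def sphereUniform (R : ℝ) : Measure Space :=
  (sphereArea R Set.univ)⁻¹ • sphereArea R

/-- The number of points among `p 1 ω, …, p (n ω) ω` that lie in `B`. -/
def pointCount {Ω E : Type*} (n : Ω → ℕ) (p : ℕ → Ω → E) (B : Set E) (ω : Ω) : ℕ :=
  {i : ℕ | i ∈ Finset.Icc 1 (n ω) ∧ p i ω ∈ B}.ncard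

/-- The random finite configuration `p 1, …, p n` is a Poisson point process with (finite)
intensity measure `Λ`: the number of points in a measurable set `B` is Poisson distributed
with mean `Λ B`, and the numbers of points in pairwise disjoint measurable sets are
independent. -/
structure IsPoissonProcess {Ω E : Type*} [MeasurableSpace Ω] [MeasurableSpace E]
    (Λ : Measure E) (n : Ω → ℕ) (p : ℕ → Ω → E) (μ : Measure Ω) : Prop where
  measurable_num : Measurable n
  measurable_point : ∀ i, Measurable (p i)
  law_count : ∀ B : Set E, MeasurableSet B →
    HasLaw (pointCount n p B) (poissonMeasure (Λ B).toNNReal) μ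
  indep_count : ∀ (k : ℕ) (B : Fin k → Set E), (∀ j, MeasurableSet (B j)) →
    Pairwise (fun i j => Disjoint (B i) (B j)) →
    iIndepFun (fun j => pointCount n p (B j)) μ

/-- The deterministic parameters of a `K`-tier network. -/
structure Network (K : ℕ) where
  /-- radius of the Earth -/
  earthRadius : ℝ
  /-- altitude of each tier -/
  altitude : Fin K → ℝ
  /-- number of satellites of each tier -/
  numSat : Fin K → ℕ
  /-- half beamwidth angle of the satellites -/
  beam : ℝ
  /-- density of the devices per unit of area of the Earth's surface -/
  density : ℝ
  /-- speed of light -/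
  c : ℝ
  /-- carrier frequency -/
  freq : ℝ
  /-- transmit power of a device -/
  power : ℝ
  /-- product of the gains of the transmitting and receiving antennas -/
  gain : ℝ
  /-- noise spectral density -/
  noiseDensity : ℝ
  /-- bandwidth -/
  bandwidth : ℝ
  /-- information-bearing ratio: the share of the power that carries the message -/
  γ : ℝ
  /-- SINR threshold of the legitimate link -/
  β : ℝ
  /-- shape parameter of the Gamma fading -/
  m₁ : ℕ
  /-- scale parameter of the Gamma fading -/
  m₂ : ℝ
  earthRadius_pos : 0 < earthRadius
  altitude_pos : ∀ k, 0 < altitude k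
  numSat_pos : ∀ k, 0 < numSat k
  beam_pos : 0 < beam
  density_pos : 0 < density
  c_pos : 0 < c
  freq_pos : 0 < freq
  power_pos : 0 < power
  gain_pos : 0 < gain
  noiseDensity_pos : 0 < noiseDensity
  bandwidth_pos : 0 < bandwidth
  γ_pos : 0 < γ
  γ_le_one : γ ≤ 1
  β_pos : 0 < β
  m₁_pos : 0 < m₁
  m₂_pos : 0 < m₂

namespace Network

variable {K : ℕ} (net : Network K) (m : Fin K)

/-- The radius of the orbital sphere of tier `m`. -/
def orbitRadius : ℝ := net.altitude m + net.earthRadius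

/-- The noise power at a satellite. -/
def noise : ℝ := net.noiseDensity * net.bandwidth

/-- The position of the typical device. -/
def typicalDevice : Space := !₂[0, 0, net.earthRadius]

open Classical in
/-- The largest central angle at which a device and a satellite of tier `m` can be linked. -/
def thetaMax : ℝ :=
  if net.beam < Real.arcsin (net.earthRadius / net.orbitRadius m) then
    Real.arcsin (net.orbitRadius m / net.earthRadius * Real.sin net.beam) - net.beam
  else
    Real.arccos (net.earthRadius / net.orbitRadius m)

/-- The distance between a device and a satellite of tier `m` at central angle `θ`. -/
def linkDistance (θ : ℝ) : ℝ :=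
  Real.sqrt (net.earthRadius ^ 2 + net.orbitRadius m ^ 2
    - 2 * net.earthRadius * net.orbitRadius m * Real.cos θ)

/-- The probability density of the contact angle in tier `m`. -/
def contactPDF (θ : ℝ) : ℝ :=
  net.numSat m * Real.sin θ / 2 * ((1 + Real.cos θ) / 2) ^ (net.numSat m - 1)

/-- The availability probability of tier `m`. -/
def availability : ℝ := 1 - ((1 + Real.cos (net.thetaMax m)) / 2) ^ net.numSat m

/-- The Laplace transform of the interference at a satellite of tier `m`. -/
def interferenceLT (s : ℝ) : ℝ :=
  Real.exp (-(net.density *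
    ∫ _φ in (0 : ℝ)..(2 * Real.pi), ∫ θ in (0 : ℝ)..(net.thetaMax m),
      (1 - (1 + net.m₂ * s * net.power * net.gain *
          (net.c / (4 * Real.pi * net.freq * net.linkDistance m θ)) ^ 2) ^ (-(net.m₁ : ℤ)))
        * (net.earthRadius ^ 2 * Real.sin θ)))

/-- The constant `(m₁!) ^ (-1 / m₁) / m₂` of the exponential approximation of the Gamma law. -/
def fadingRate : ℝ := (net.m₁.factorial : ℝ) ^ (-(1 : ℝ) / (net.m₁ : ℝ)) / net.m₂

/-- The approximation, on the half-line `0 ≤ x`, of the distribution function of the fading by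
that of the Gamma law. -/
def approxCDF (x : ℝ) : ℝ := (1 - Real.exp (-(net.fadingRate * x))) ^ net.m₁

/-- The quantity `s_LS`, as a function of the contact angle. -/
def sLS (θ : ℝ) : ℝ :=
  net.fadingRate * (net.β / (net.γ * net.power * net.gain)) *
    (4 * Real.pi * net.freq * net.linkDistance m θ / net.c) ^ 2

/-- The closed form of the coverage probability. -/
def coverageFormula : ℝ :=
  ∑ q ∈ Finset.Icc 1 net.m₁, (net.m₁.choose q : ℝ) * (-1) ^ (q + 1) *
    ∫ θ in (0 : ℝ)..(net.thetaMax m),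
      Real.exp (-(q * net.sLS m θ * net.noise)) *
        net.interferenceLT m (q * net.sLS m θ) * net.contactPDF m θ

open Classical in
/-- The power that a satellite of tier `m` at `x` receives from a device at `u` when the power of
the small-scale fading is `g`. No power is received across a link that leaves the main lobe or
the line of sight. -/
def receivedPower (u x : Space) (g : ℝ) : ℝ :=
  if InnerProductGeometry.angle u x < net.thetaMax m then
    net.power * (net.c / (4 * Real.pi * net.freq * dist u x)) ^ 2 * net.gain * g
  else 0

end Network

/-- The random uplink of the typical device (device `0`) to its nearest satellite in tier `m`.
`ν` is the law of the fading power on the link of the typical device. -/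
structure Uplink {K : ℕ} (net : Network K) (m : Fin K) (ν : Measure ℝ)
    {Ω : Type*} [MeasurableSpace Ω] (μ : Measure Ω) where
  /-- positions of the satellites of tier `m` -/
  sat : Fin (net.numSat m) → Ω → Space
  /-- number of the other devices -/
  numDev : Ω → ℕ
  /-- positions of the devices; the other devices are those with index `1, …, numDev` -/
  dev : ℕ → Ω → Space
  /-- power of the small-scale fading between each device and the serving satellite -/
  fading : ℕ → Ω → ℝ
  /-- index of the serving satellite -/
  serving : Ω → Fin (net.numSat m)
  /-- the satellites form a binomial point process -/
  sat_law : ∀ j, HasLaw (sat j) (sphereUniform (net.orbitRadius m)) μ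
  sat_measurable : ∀ j, Measurable (sat j)
  sat_indep : iIndepFun sat μ
  dev_zero : ∀ ω, dev 0 ω = net.typicalDevice
  /-- the other devices form a homogeneous Poisson point process on the surface of the Earth -/
  dev_poisson : IsPoissonProcess
    (ENNReal.ofReal net.density • sphereArea net.earthRadius) numDev dev μ
  fading_measurable : ∀ i, Measurable (fading i)
  fading_zero_law : HasLaw (fading 0) ν μ
  /-- the fading of the interfering devices is Gamma with shape `m₁` and scale `m₂` -/
  fading_law : ∀ i, i ≠ 0 → HasLaw (fading i) (gammaMeasure (net.m₁ : ℝ) (1 / net.m₂)) μ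
  fading_indep : iIndepFun fading μ
  /-- satellites, devices and fading are mutually independent -/
  indep_sat_dev : IndepFun (fun ω j => sat j ω) (fun ω => (numDev ω, fun i => dev i ω)) μ
  indep_fading : IndepFun (fun ω i => fading i ω)
    (fun ω => ((fun j => sat j ω), (numDev ω, fun i => dev i ω))) μ
  /-- the typical device is served by its nearest satellite -/
  serving_nearest : ∀ ω j,
    dist net.typicalDevice (sat (serving ω) ω) ≤ dist net.typicalDevice (sat j ω)

namespace Uplink

variable {K : ℕ} {net : Network K} {m : Fin K} {ν : Measure ℝ}
  {Ω : Type*} [MeasurableSpace Ω] {μ : Measure Ω} (S : Uplink net m ν μ)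

/-- The power that the serving satellite receives from device `i`. -/
def power (i : ℕ) (ω : Ω) : ℝ :=
  net.receivedPower m (S.dev i ω) (S.sat (S.serving ω) ω) (S.fading i ω)

/-- The interference at the serving satellite. -/
def interference (ω : Ω) : ℝ := ∑ i ∈ Finset.Icc 1 (S.numDev ω), S.power i ω

/-- The SINR at the serving satellite. -/
def sinr (ω : Ω) : ℝ := net.γ * S.power 0 ω / (S.interference ω + net.noise)

/-- The coverage probability. -/
def coverage : ℝ := μ.real {ω | net.β < S.sinr ω}

end Uplink

end

end LEOUplink

namespace LEOUplink

noncomputable section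

/-! If the serving satellite is seen at central angle θ below `thetaMax`, coverage means that the
fading of the typical device exceeds T = w(θ)(I + σ²), with w = `thresholdScale` and I the
interference. This fading is independent of T, so conditioning gives coverage = ∫ (1 - F) dτ, where
τ = `thresholdMeasure` is the law of T on the linked event (`coverage_eq_integral`). Likewise Q = ∫
(1 - A) dτ (`coverageFormula_eq_integral`). Every assertion then compares F with A under one
positive measure, carried by [0, ∞) and of total mass `availability`.

For the second identity, the binomial theorem writes 1 - A(t) as a combination of the functions
exp(-qκt), so only the Laplace transform of τ at the points qκ is needed. Since κw = `sLS`, it is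
the expectation of exp(-q s σ²) exp(-q s I) on the linked event, with s = `sLS` at the contact
angle. Given the satellites, I is a sum over a Poisson process with Gamma marks, and
`lintegral_mul_prod_exp_neg_gamma` gives its transform. The resulting integral over the Earth
depends on central angles only; `lintegral_toSphere_angle` reduces it to one variable, which
produces `interferenceLT`. The law of the smallest of independent angles
(`lintegral_indicator_nearest`) supplies the density `contactPDF`. -/

/-! ### Independence, random indices, Gamma and Poisson transforms -/

theorem lintegral_comp_of_indepFun {Ω α β : Type*} [MeasurableSpace Ω] [MeasurableSpace α]
    [MeasurableSpace β] {μ : Measure Ω} [IsProbabilityMeasure μ] {X : Ω → α} {Y : Ω → β}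
    (hX : Measurable X) (hY : Measurable Y) (h : IndepFun X Y μ) {f : α → β → ENNReal}
    (hf : Measurable (Function.uncurry f)) :
    ∫⁻ ω, f (X ω) (Y ω) ∂μ = ∫⁻ ω, ∫⁻ ω', f (X ω) (Y ω') ∂μ ∂μ := by
  have := Measure.isProbabilityMeasure_map (μ := μ) hX.aemeasurable
  have := Measure.isProbabilityMeasure_map (μ := μ) hY.aemeasurable
  have h1 := (indepFun_iff_map_prod_eq_prod_map_map hX.aemeasurable hY.aemeasurable).1 h
  calc ∫⁻ ω, f (X ω) (Y ω) ∂μ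
      = ∫⁻ p, Function.uncurry f p ∂(μ.map fun ω => (X ω, Y ω)) := by
        rw [lintegral_map hf (hX.prodMk hY)]; rfl
    _ = ∫⁻ x, ∫⁻ y, f x y ∂(μ.map Y) ∂(μ.map X) := by
        rw [h1, lintegral_prod _ hf.aemeasurable]; rfl
    _ = ∫⁻ ω, ∫⁻ ω', f (X ω) (Y ω') ∂μ ∂μ := by
        rw [lintegral_map (Measurable.lintegral_prod_right hf) hX]
        refine lintegral_congr fun ω => ?_
        exact lintegral_map (f := f (X ω)) (hf.comp measurable_prodMk_left) hY

/-- Associativity of the product measure. It serves to separate the fading of the typical device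
from everything else at once. -/
theorem indepFun_prodMk_assoc {Ω α β γ : Type*} [MeasurableSpace Ω] [MeasurableSpace α]
    [MeasurableSpace β] [MeasurableSpace γ] {μ : Measure Ω} [IsProbabilityMeasure μ]
    {X : Ω → α} {Y : Ω → β} {Z : Ω → γ}
    (hX : Measurable X) (hY : Measurable Y) (hZ : Measurable Z) (hXY : IndepFun X Y μ)
    (h : IndepFun (fun ω => (X ω, Y ω)) Z μ) : IndepFun X (fun ω => (Y ω, Z ω)) μ := by
  have := Measure.isProbabilityMeasure_map (μ := μ) hX.aemeasurable
  have := Measure.isProbabilityMeasure_map (μ := μ) hY.aemeasurable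
  have := Measure.isProbabilityMeasure_map (μ := μ) hZ.aemeasurable
  have hYZ : IndepFun Y Z μ := h.comp measurable_snd measurable_id
  rw [indepFun_iff_map_prod_eq_prod_map_map (by fun_prop) (by fun_prop)] at *
  rw [hYZ, ← MeasurePreserving.map_eq (measurePreserving_prodAssoc _ _ _), ← hXY, ← h,
    Measure.map_map (by fun_prop) (by fun_prop)]
  rfl

/-- Used for sums and products over a random number of devices: the index set is countable, so each
fixed index can be treated alone. -/
theorem measurable_comp_nat {α β : Type*} [MeasurableSpace α] [MeasurableSpace β]
    {F : ℕ → α → β} (hF : ∀ n, Measurable (F n)) {N : α → ℕ} (hN : Measurable N) :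
    Measurable fun a => F (N a) a :=
  (measurable_from_prod_countable_right (f := fun p : ℕ × α => F p.1 p.2) hF).comp
    (hN.prodMk measurable_id)

/-- Exponential tilting: exp(-bx) times the Gamma density of rate r is a constant times the Gamma
density of rate r + b, and the constant is the transform. -/
theorem lintegral_exp_neg_mul_gammaMeasure {k : ℕ} (hk : 0 < k) {r b : ℝ} (hr : 0 < r)
    (hb : 0 ≤ b) :
    ∫⁻ x, ENNReal.ofReal (Real.exp (-(b * x))) ∂(gammaMeasure (k : ℝ) r)
      = ENNReal.ofReal ((1 + b / r) ^ (-(k : ℤ))) := by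
  have hk' : (0 : ℝ) < k := by exact_mod_cast hk
  have hrb : 0 < r + b := by positivity
  rw [gammaMeasure, lintegral_withDensity_eq_lintegral_mul _
    (by unfold gammaPDF; fun_prop) (by fun_prop)]
  have key : ∀ x, (gammaPDF (k : ℝ) r * fun x => ENNReal.ofReal (Real.exp (-(b * x)))) x
      = ENNReal.ofReal ((1 + b / r) ^ (-(k : ℤ))) * gammaPDF (k : ℝ) (r + b) x := by
    intro x
    simp only [Pi.mul_apply, gammaPDF]
    rw [← ENNReal.ofReal_mul (gammaPDFReal_nonneg hk' hr x), ← ENNReal.ofReal_mul (by positivity)]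
    congr 1
    unfold gammaPDFReal
    split_ifs with hx
    · have e1 : Real.exp (-((r + b) * x)) = Real.exp (-(r * x)) * Real.exp (-(b * x)) := by
        rw [← Real.exp_add]; ring_nf
      have e2 : (1 + b / r) ^ (-(k : ℤ)) = r ^ k / (r + b) ^ k := by
        rw [zpow_neg, zpow_natCast, ← div_pow, ← inv_pow]
        congr 1
        field_simp
      rw [e1, e2, Real.rpow_natCast, Real.rpow_natCast]
      field_simp
    · simp
  simp_rw [key]
  rw [lintegral_const_mul _ (by unfold gammaPDF; fun_prop), lintegral_gammaPDF_eq_one hk' hrb,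
    mul_one]

theorem integral_pow_poissonMeasure (r : NNReal) (a : ℝ) :
    ∫ n, a ^ n ∂(poissonMeasure r) = Real.exp (-(r * (1 - a))) := by
  rw [integral_poissonMeasure]
  have h := (NormedSpace.expSeries_div_hasSum_exp (𝔸 := ℝ) ((r : ℝ) * a)).tsum_eq
  rw [← Real.exp_eq_exp_ℝ] at h
  have : ∀ n : ℕ, (Real.exp (-r) * (r : ℝ) ^ n / (n.factorial : ℝ)) • a ^ n
      = Real.exp (-r) * ((r * a) ^ n / (n.factorial : ℝ)) := by
    intro n; rw [smul_eq_mul, mul_pow]; ring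
  simp_rw [this]
  rw [tsum_mul_left, h, ← Real.exp_add]
  ring_nf

theorem ae_nonneg_gammaMeasure (a r : ℝ) : ∀ᵐ x ∂(gammaMeasure a r), 0 ≤ x := by
  rw [gammaMeasure, ae_withDensity_iff (by unfold gammaPDF; fun_prop)]
  refine ae_of_all _ fun x hx => ?_
  by_contra h
  exact hx (gammaPDF_of_neg (not_le.1 h))

/-! ### Laplace functional of a Poisson process -/

namespace IsPoissonProcess

variable {Ω E : Type*} [MeasurableSpace Ω] [MeasurableSpace E] {Λ : Measure E} {n : Ω → ℕ}
  {p : ℕ → Ω → E} {μ : Measure Ω}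

/-- Grouping the points by cell turns the product into powers of the cell counts. These counts are
independent and Poisson, so the generating functions multiply and the exponents add up to an
integral. -/
theorem integral_prod_comp_of_fin [IsFiniteMeasure Λ] [IsProbabilityMeasure μ]
    (h : IsPoissonProcess Λ n p μ)
    {k : ℕ} {idx : E → Fin k} (hidx : Measurable idx) (a : Fin k → ℝ) :
    ∫ ω, ∏ i ∈ Finset.Icc 1 (n ω), a (idx (p i ω)) ∂μ
      = Real.exp (-∫ u, (1 - a (idx u)) ∂Λ) := by
  classical
  set B : Fin k → Set E := fun j => idx ⁻¹' {j} with hB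
  have hBm : ∀ j, MeasurableSet (B j) := fun j => hidx (measurableSet_singleton j)
  have hBd : Pairwise fun i j => Disjoint (B i) (B j) := fun i j hij =>
    Disjoint.preimage _ (by simpa using hij)
  have hprod : ∀ ω, ∏ i ∈ Finset.Icc 1 (n ω), a (idx (p i ω))
      = ∏ j, a j ^ pointCount n p (B j) ω := by
    intro ω
    rw [← Finset.prod_fiberwise (Finset.Icc 1 (n ω)) (fun i => idx (p i ω))]
    refine Finset.prod_congr rfl fun j _ => ?_
    rw [Finset.prod_congr rfl (g := fun _ => a j)
      (fun i hi => by rw [(Finset.mem_filter.1 hi).2]), Finset.prod_const]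
    congr 1
    rw [pointCount, ← Set.ncard_coe_finset]
    congr 1
    ext i
    simp [hB]
  simp_rw [hprod]
  rw [(h.indep_count k B hBm hBd).integral_fun_prod_comp (f := fun j N => a j ^ N)
    (fun j => (h.law_count _ (hBm j)).aemeasurable) (fun j => .of_discrete)]
  have hj : ∀ j, ∫ ω, a j ^ pointCount n p (B j) ω ∂μ
      = Real.exp (-(Λ.real (B j) * (1 - a j))) := by
    intro j
    have := (h.law_count _ (hBm j)).integral_comp (f := fun N : ℕ => a j ^ N) .of_discrete
    simp only [Function.comp_def] at this
    rw [this, integral_pow_poissonMeasure]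
    rfl
  simp_rw [hj]
  rw [← Real.exp_sum, Finset.sum_neg_distrib]
  congr 2
  have := Measure.isFiniteMeasure_map Λ idx
  rw [← integral_map (f := fun j => 1 - a j) hidx.aemeasurable .of_discrete,
    integral_fintype .of_finite]
  refine Finset.sum_congr rfl fun j _ => ?_
  rw [smul_eq_mul, map_measureReal_apply hidx (measurableSet_singleton j)]

/-- The function is approximated by ⌊kv⌋/k, which takes finitely many values in [0, 1]; bounded
convergence applies on both sides. -/
theorem integral_prod [IsFiniteMeasure Λ] [IsProbabilityMeasure μ]
    (h : IsPoissonProcess Λ n p μ) {v : E → ℝ} (hv : Measurable v) (hv0 : ∀ u, 0 ≤ v u)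
    (hv1 : ∀ u, v u ≤ 1) :
    ∫ ω, ∏ i ∈ Finset.Icc 1 (n ω), v (p i ω) ∂μ = Real.exp (-∫ u, (1 - v u) ∂Λ) := by
  have hfl : ∀ (k : ℕ) u, ⌊v u * k⌋₊ < k + 1 := fun k u =>
    Nat.lt_succ_of_le (Nat.floor_le_of_le (by
      have := hv1 u; nlinarith [(Nat.cast_nonneg k : (0 : ℝ) ≤ k)]))
  -- The value k occurs where v = 1, hence k + 1 cells. For k = 0 the quotient is 0, which is
  -- harmless in the limit.
  let idx : (k : ℕ) → E → Fin (k + 1) := fun k u => ⟨⌊v u * k⌋₊, hfl k u⟩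
  let w : ℕ → E → ℝ := fun k u => (⌊v u * k⌋₊ : ℝ) / k
  have hidx : ∀ k, Measurable (idx k) := fun k => by
    refine measurable_to_countable' fun j => ?_
    have : idx k ⁻¹' {j} = (fun u => ⌊v u * k⌋₊) ⁻¹' {(j : ℕ)} := by
      ext u; simp [idx, Fin.ext_iff]
    rw [this]
    exact (hv.mul_const _).nat_floor (measurableSet_singleton _)
  have hw : ∀ k, Measurable (w k) := fun k => by
    have : Measurable fun u => ⌊v u * k⌋₊ := (hv.mul_const _).nat_floor
    exact (measurable_from_top (f := fun n : ℕ => (n : ℝ) / k)).comp this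
  have hw0 : ∀ k u, 0 ≤ w k u := fun k u => by positivity
  have hw1 : ∀ k u, w k u ≤ 1 := fun k u => by
    refine div_le_one_of_le₀ ?_ (by positivity)
    exact_mod_cast Nat.lt_succ_iff.1 (hfl k u)
  have hlim : ∀ u, Filter.Tendsto (fun k => w k u) Filter.atTop (nhds (v u)) := fun u =>
    (tendsto_nat_floor_mul_div_atTop (hv0 u)).comp tendsto_natCast_atTop_atTop
  have hstep : ∀ k, ∫ ω, ∏ i ∈ Finset.Icc 1 (n ω), w k (p i ω) ∂μ
      = Real.exp (-∫ u, (1 - w k u) ∂Λ) := fun k =>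
    h.integral_prod_comp_of_fin (hidx k) fun j => (j : ℝ) / k
  have hL : Filter.Tendsto (fun k => ∫ ω, ∏ i ∈ Finset.Icc 1 (n ω), w k (p i ω) ∂μ)
      Filter.atTop (nhds (∫ ω, ∏ i ∈ Finset.Icc 1 (n ω), v (p i ω) ∂μ)) := by
    refine tendsto_integral_of_dominated_convergence (fun _ => 1) (fun k => ?_)
      (integrable_const _) (fun k => ae_of_all _ fun ω => ?_) (ae_of_all _ fun ω => ?_)
    · refine Measurable.aestronglyMeasurable ?_
      exact measurable_comp_nat (F := fun N ω => ∏ i ∈ Finset.Icc 1 N, w k (p i ω))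
        (fun N => Finset.measurable_fun_prod _ fun i _ => (hw k).comp (h.measurable_point i))
        h.measurable_num
    · rw [Real.norm_of_nonneg (Finset.prod_nonneg fun i _ => hw0 k _)]
      exact Finset.prod_le_one (fun i _ => hw0 k _) fun i _ => hw1 k _
    · exact tendsto_finsetProd _ fun i _ => hlim _
  have hR : Filter.Tendsto (fun k => Real.exp (-∫ u, (1 - w k u) ∂Λ))
      Filter.atTop (nhds (Real.exp (-∫ u, (1 - v u) ∂Λ))) := by
    refine (Real.continuous_exp.tendsto _).comp (Filter.Tendsto.neg ?_)
    refine tendsto_integral_of_dominated_convergence (fun _ => 1)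
      (fun k => (measurable_const.sub (hw k)).aestronglyMeasurable)
      (integrable_const _) (fun k => ae_of_all _ fun u => ?_)
      (ae_of_all _ fun u => (hlim u).const_sub 1)
    rw [Real.norm_of_nonneg (by linarith [hw1 k u])]
    linarith [hw0 k u]
  simp_rw [hstep] at hL
  exact tendsto_nhds_unique hL hR

theorem lintegral_prod [IsFiniteMeasure Λ] [IsProbabilityMeasure μ]
    (h : IsPoissonProcess Λ n p μ) {v : E → ℝ} (hv : Measurable v) (hv0 : ∀ u, 0 ≤ v u)
    (hv1 : ∀ u, v u ≤ 1) :
    ∫⁻ ω, ∏ i ∈ Finset.Icc 1 (n ω), ENNReal.ofReal (v (p i ω)) ∂μ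
      = ENNReal.ofReal (Real.exp (-∫ u, (1 - v u) ∂Λ)) := by
  have hm : Measurable fun ω => ∏ i ∈ Finset.Icc 1 (n ω), v (p i ω) :=
    measurable_comp_nat (F := fun N ω => ∏ i ∈ Finset.Icc 1 N, v (p i ω))
      (fun N => Finset.measurable_fun_prod _ fun i _ => hv.comp (h.measurable_point i))
      h.measurable_num
  rw [← h.integral_prod hv hv0 hv1, ofReal_integral_eq_lintegral_ofReal]
  · refine lintegral_congr fun ω => ?_
    rw [ENNReal.ofReal_prod_of_nonneg fun i _ => hv0 _]
  · refine Integrable.of_bound (C := 1) hm.aestronglyMeasurable (ae_of_all _ fun ω => ?_)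
    rw [Real.norm_of_nonneg (Finset.prod_nonneg fun i _ => hv0 _)]
    exact Finset.prod_le_one (fun i _ => hv0 _) fun i _ => hv1 _
  · exact ae_of_all _ fun ω => Finset.prod_nonneg fun i _ => hv0 _

end IsPoissonProcess

/-- The Laplace functional of a Poisson process with independent Gamma marks, in a random
environment `X` that is independent of the process and of the marks. -/
theorem lintegral_mul_prod_exp_neg_gamma {Ω E α : Type*} [MeasurableSpace Ω] [MeasurableSpace E]
    [MeasurableSpace α] {μ : Measure Ω} [IsProbabilityMeasure μ] {Λ : Measure E}
    [IsFiniteMeasure Λ] {n : Ω → ℕ} {p : ℕ → Ω → E} (hp : IsPoissonProcess Λ n p μ)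
    {X : Ω → α} (hX : Measurable X) {h : ℕ → Ω → ℝ} (hm : ∀ i, Measurable (h i))
    {k : ℕ} (hk : 0 < k) {r : ℝ} (hr : 0 < r)
    (hlaw : ∀ i, i ≠ 0 → HasLaw (h i) (gammaMeasure (k : ℝ) r) μ) (hind : iIndepFun h μ)
    (hXp : IndepFun X (fun ω => (n ω, fun i => p i ω)) μ)
    (hh : IndepFun (fun ω i => h i ω) (fun ω => (X ω, (n ω, fun i => p i ω))) μ)
    {A : α → ENNReal} (hA : Measurable A) {g : α → E → ℝ} (hg : Measurable (Function.uncurry g))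
    (hg0 : ∀ x u, 0 ≤ g x u) :
    ∫⁻ ω, A (X ω) * ∏ i ∈ Finset.Icc 1 (n ω),
        ENNReal.ofReal (Real.exp (-(g (X ω) (p i ω) * h i ω))) ∂μ
      = ∫⁻ ω, A (X ω) * ENNReal.ofReal
          (Real.exp (-∫ u, (1 - (1 + g (X ω) u / r) ^ (-(k : ℤ))) ∂Λ)) ∂μ := by
  have hD : Measurable fun ω => (n ω, fun i => p i ω) :=
    hp.measurable_num.prodMk (measurable_pi_lambda _ hp.measurable_point)
  have hH : Measurable fun ω i => h i ω := measurable_pi_lambda _ hm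
  have hv : Measurable fun q : α × E => (1 + g q.1 q.2 / r) ^ (-(k : ℤ)) := by
    simp_rw [zpow_neg, zpow_natCast]
    exact ((measurable_const.add (hg.div_const r)).pow_const k).inv
  -- The marks are integrated out first, with environment and points frozen; each contributes one
  -- Gamma transform.
  rw [lintegral_comp_of_indepFun (hX.prodMk hD) hH hh.symm
    (f := fun a h => A a.1 * ∏ i ∈ Finset.Icc 1 a.2.1,
        ENNReal.ofReal (Real.exp (-(g a.1 (a.2.2 i) * h i))))]
  swap
  · refine (hA.comp (measurable_fst.comp measurable_fst)).mul ?_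
    refine measurable_comp_nat
      (F := fun N (q : (α × ℕ × (ℕ → E)) × (ℕ → ℝ)) => ∏ i ∈ Finset.Icc 1 N,
        ENNReal.ofReal (Real.exp (-(g q.1.1 (q.1.2.2 i) * q.2 i)))) (fun N => ?_) (by fun_prop)
    refine Finset.measurable_fun_prod _ fun i _ => ?_
    have : Measurable fun q : (α × ℕ × (ℕ → E)) × (ℕ → ℝ) => g q.1.1 (q.1.2.2 i) :=
      hg.comp (f := fun q : (α × ℕ × (ℕ → E)) × (ℕ → ℝ) => (q.1.1, q.1.2.2 i)) (by fun_prop)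
    fun_prop
  have h1 : ∀ ω, ∫⁻ ω', A (X ω) * ∏ i ∈ Finset.Icc 1 (n ω),
        ENNReal.ofReal (Real.exp (-(g (X ω) (p i ω) * h i ω'))) ∂μ
      = A (X ω) * ∏ i ∈ Finset.Icc 1 (n ω),
          ENNReal.ofReal ((1 + g (X ω) (p i ω) / r) ^ (-(k : ℤ))) := by
    intro ω
    rw [lintegral_const_mul]
    swap
    · exact Finset.measurable_fun_prod _ fun i _ => by have := hm i; fun_prop
    rw [lintegral_prod_eq_prod_lintegral_of_indepFun (Finset.Icc 1 (n ω))
      (fun i ω' => ENNReal.ofReal (Real.exp (-(g (X ω) (p i ω) * h i ω'))))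
      (hind.comp (fun i y => ENNReal.ofReal (Real.exp (-(g (X ω) (p i ω) * y))))
        fun i => by fun_prop)
      (fun i => by have := hm i; fun_prop)]
    congr 1
    refine Finset.prod_congr rfl fun i hi => ?_
    have hi0 : i ≠ 0 := by have := (Finset.mem_Icc.1 hi).1; omega
    have := (hlaw i hi0).lintegral_comp
      (f := fun y => ENNReal.ofReal (Real.exp (-(g (X ω) (p i ω) * y)))) (by fun_prop)
    rw [this, lintegral_exp_neg_mul_gammaMeasure hk hr (hg0 _ _)]
  simp only
  simp_rw [h1]
  -- Now the environment alone is frozen and the Poisson functional applies to a deterministic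
  -- function.
  rw [lintegral_comp_of_indepFun hX hD hXp
    (f := fun x d => A x * ∏ i ∈ Finset.Icc 1 d.1,
          ENNReal.ofReal ((1 + g x (d.2 i) / r) ^ (-(k : ℤ))))]
  swap
  · refine (hA.comp measurable_fst).mul ?_
    refine measurable_comp_nat
      (F := fun N (q : α × ℕ × (ℕ → E)) => ∏ i ∈ Finset.Icc 1 N,
        ENNReal.ofReal ((1 + g q.1 (q.2.2 i) / r) ^ (-(k : ℤ)))) (fun N => ?_) (by fun_prop)
    refine Finset.measurable_fun_prod _ fun i _ => ENNReal.measurable_ofReal.comp ?_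
    exact hv.comp (f := fun q : α × ℕ × (ℕ → E) => (q.1, q.2.2 i)) (by fun_prop)
  refine lintegral_congr fun ω => ?_
  have hvω : Measurable fun u => (1 + g (X ω) u / r) ^ (-(k : ℤ)) :=
    hv.comp (f := fun u => (X ω, u)) (by fun_prop)
  have hb : ∀ u, 1 ≤ 1 + g (X ω) u / r := fun u => by
    have := hg0 (X ω) u
    have : 0 ≤ g (X ω) u / r := by positivity
    linarith
  rw [lintegral_const_mul]
  swap
  · refine measurable_comp_nat (F := fun N ω' => ∏ i ∈ Finset.Icc 1 N,
      ENNReal.ofReal ((1 + g (X ω) (p i ω') / r) ^ (-(k : ℤ)))) (fun N => ?_) hp.measurable_num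
    exact Finset.measurable_fun_prod _ fun i _ =>
      ENNReal.measurable_ofReal.comp (hvω.comp (hp.measurable_point i))
  rw [hp.lintegral_prod hvω (fun u => zpow_nonneg (by linarith [hb u]) _)
    fun u => zpow_le_one_of_nonpos₀ (hb u) (by simp)]

/-! ### Spherical coordinates and the distribution of angles on a sphere -/

-- Polar coordinates used twice: in the plane of the last two coordinates, where the integrand is
-- radial, and then in the plane of the first coordinate and that radius.
open InnerProductGeometry Set Real in
theorem lintegral_fst_norm (H : ℝ → ℝ → ENNReal) (hH : Measurable (Function.uncurry H)) :
    ∫⁻ y : Space, H (y 0) ‖y‖ = ENNReal.ofReal (2 * π) *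
      ∫⁻ ρ in Ioi (0 : ℝ), ∫⁻ θ in Ioo (-π) π,
        ENNReal.ofReal ρ * (ENNReal.ofReal (ρ * sin θ) * H (ρ * cos θ) ρ) := by
  have hm : ∀ {α : Type} [MeasurableSpace α] {f g : α → ℝ}, Measurable f → Measurable g →
      Measurable fun a => H (f a) (g a) := fun hf hg => hH.comp (hf.prodMk hg)
  have e1 : ∫⁻ y : Space, H (y 0) ‖y‖
      = ∫⁻ z : ℝ, ∫⁻ w : ℝ × ℝ, H z (√(z ^ 2 + (w.1 ^ 2 + w.2 ^ 2))) := by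
    have h1 := (PiLp.volume_preserving_ofLp (Fin 3)).lintegral_comp
      (f := fun y : Fin 3 → ℝ => H (y 0) (√(y 0 ^ 2 + (y 1 ^ 2 + y 2 ^ 2))))
      (hm (by fun_prop) (by fun_prop))
    have h2 := (volume_preserving_piFinSuccAbove (fun _ : Fin 3 => ℝ) 0).lintegral_comp
      (f := fun q : ℝ × (Fin 2 → ℝ) => H q.1 (√(q.1 ^ 2 + (q.2 0 ^ 2 + q.2 1 ^ 2))))
      (hm (by fun_prop) (by fun_prop))
    have h3 : ∀ z, _ := fun z : ℝ => (volume_preserving_finTwoArrow ℝ).lintegral_comp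
      (f := fun w : ℝ × ℝ => H z (√(z ^ 2 + (w.1 ^ 2 + w.2 ^ 2))))
      (hm (by fun_prop) (by fun_prop))
    simp_rw [← h3]
    rw [Measure.volume_eq_prod, lintegral_prod _ (hm (by fun_prop) (by fun_prop)).aemeasurable]
      at h2
    refine Eq.trans ?_ (h1.trans ?_)
    · refine lintegral_congr fun y => ?_
      rw [EuclideanSpace.norm_eq, Fin.sum_univ_three]
      simp [sq_abs, add_assoc]
    · exact h2
  have e2 : ∀ z : ℝ, ∫⁻ w : ℝ × ℝ, H z (√(z ^ 2 + (w.1 ^ 2 + w.2 ^ 2)))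
      = ENNReal.ofReal (2 * π) * ∫⁻ r, ENNReal.ofReal r * H z (√(z ^ 2 + r ^ 2)) := by
    intro z
    rw [← lintegral_comp_polarCoord_symm, polarCoord_target, Measure.volume_eq_prod,
      setLIntegral_prod]
    swap
    · exact Measurable.aemeasurable ((ENNReal.measurable_ofReal.comp measurable_fst).mul
        (hm (by fun_prop) (by simp only [polarCoord_symm_apply]; fun_prop)))
    have : ∀ r φ : ℝ, z ^ 2 + ((r * cos φ) ^ 2 + (r * sin φ) ^ 2) = z ^ 2 + r ^ 2 := by
      intro r φ
      have := sin_sq_add_cos_sq φ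
      linear_combination r ^ 2 * this
    simp only [polarCoord_symm_apply, this, smul_eq_mul, lintegral_const, Measure.restrict_apply,
      MeasurableSet.univ, univ_inter, Real.volume_Ioo]
    have hz : Measurable fun r : ℝ => ENNReal.ofReal r * H z (√(z ^ 2 + r ^ 2)) :=
      ENNReal.measurable_ofReal.mul
        (hm (f := fun _ => z) (g := fun r => √(z ^ 2 + r ^ 2)) (by fun_prop) (by fun_prop))
    rw [lintegral_mul_const _ hz, mul_comm]
    congr 1
    · congr 1; ring
    -- `ENNReal.ofReal r` vanishes for r ≤ 0, so r may range over the whole line, and polar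
    -- coordinates of the full plane can be used again.
    · rw [← lintegral_indicator measurableSet_Ioi]
      refine lintegral_congr fun r => ?_
      by_cases hr : 0 < r
      · simp [hr]
      · simp [hr, ENNReal.ofReal_of_nonpos (not_lt.1 hr)]
  have hmeas : Measurable fun q : ℝ × ℝ => ENNReal.ofReal q.2 * H q.1 (√(q.1 ^ 2 + q.2 ^ 2)) :=
    (ENNReal.measurable_ofReal.comp measurable_snd).mul
      (hm (f := fun q : ℝ × ℝ => q.1) (g := fun q : ℝ × ℝ => √(q.1 ^ 2 + q.2 ^ 2))
        (by fun_prop) (by fun_prop))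
  rw [e1]
  simp_rw [e2]
  rw [lintegral_const_mul]
  swap
  · exact Measurable.lintegral_prod_right' (f := fun q : ℝ × ℝ =>
      ENNReal.ofReal q.2 * H q.1 (√(q.1 ^ 2 + q.2 ^ 2))) hmeas
  congr 1
  rw [← lintegral_prod (fun q : ℝ × ℝ => ENNReal.ofReal q.2 * H q.1 (√(q.1 ^ 2 + q.2 ^ 2)))
    hmeas.aemeasurable, ← Measure.volume_eq_prod, ← lintegral_comp_polarCoord_symm,
    polarCoord_target, Measure.volume_eq_prod, setLIntegral_prod]
  swap
  · exact Measurable.aemeasurable ((ENNReal.measurable_ofReal.comp measurable_fst).mul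
      (hmeas.comp (continuous_polarCoord_symm.measurable)))
  refine setLIntegral_congr_fun measurableSet_Ioi fun ρ hρ => ?_
  refine lintegral_congr fun θ => ?_
  have : (ρ * cos θ) ^ 2 + (ρ * sin θ) ^ 2 = ρ ^ 2 := by
    have := sin_sq_add_cos_sq θ
    linear_combination ρ ^ 2 * this
  simp only [polarCoord_symm_apply, this, smul_eq_mul, sqrt_sq (le_of_lt hρ)]

-- Rotation invariance of volume: e is completed to an orthonormal basis in which it is the first
-- vector.
open InnerProductGeometry Set Real in
theorem lintegral_inner_norm {e : Space} (he : ‖e‖ = 1) (H : ℝ → ℝ → ENNReal)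
    (hH : Measurable (Function.uncurry H)) :
    ∫⁻ y : Space, H (inner ℝ e y) ‖y‖ = ∫⁻ y : Space, H (y 0) ‖y‖ := by
  have horth : Orthonormal ℝ (({0} : Set (Fin 3)).domRestrict fun _ => e) := by
    rw [orthonormal_iff_ite]
    rintro ⟨i, rfl⟩ ⟨j, rfl⟩
    simp [Set.domRestrict, he]
  obtain ⟨b, hb⟩ := horth.exists_orthonormalBasis_extension_of_card_eq (by simp)
  have hb0 : b 0 = e := hb 0 rfl
  rw [← b.measurePreserving_repr.lintegral_comp (f := fun y : Space => H (y 0) ‖y‖)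
    (hH.comp (f := fun y : Space => (y 0, ‖y‖)) (by fun_prop))]
  refine lintegral_congr fun y => ?_
  rw [b.repr_apply_apply, hb0, LinearIsometryEquiv.norm_map]

-- The function g(angle) on the open unit ball is integrated in two ways, by the radial
-- decomposition that defines `toSphere` and by spherical coordinates. Both contain the radial
-- factor 1/3, which cancels.
open InnerProductGeometry Set Real in
theorem lintegral_toSphere_angle {e : Space} (he : ‖e‖ = 1) {g : ℝ → ENNReal}
    (hg : Measurable g) :
    ∫⁻ n : Metric.sphere (0 : Space) 1, g (angle (n : Space) e) ∂(volume : Measure Space).toSphere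
      = ENNReal.ofReal (2 * π) * ∫⁻ θ in Ioo 0 π, ENNReal.ofReal (sin θ) * g θ := by
  have hang : ∀ y : Space, angle y e = arccos (inner ℝ e y / ‖y‖) := by
    intro y; rw [angle, he, mul_one, real_inner_comm]
  -- The cut-off at radius 1 keeps the radial factor finite and nonzero, so that it can be
  -- cancelled.
  let H : ℝ → ℝ → ENNReal := fun t r => (Iio (1 : ℝ)).indicator (fun _ => g (arccos (t / r))) r
  have hH : Measurable (Function.uncurry H) := by
    have : Function.uncurry H = ((fun q : ℝ × ℝ => q.2) ⁻¹' Iio 1).indicator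
        (fun q => g (arccos (q.1 / q.2))) := by
      ext q; rfl
    rw [this]
    refine Measurable.indicator (hg.comp ?_) (measurable_snd measurableSet_Iio)
    exact measurable_arccos.comp (measurable_fst.div measurable_snd)
  have hvol : ∫⁻ ρ in Ioi (0 : ℝ), (Iio (1 : ℝ)).indicator
      (fun ρ => ENNReal.ofReal (ρ ^ 2)) ρ = ENNReal.ofReal (1 / 3) := by
    rw [lintegral_indicator measurableSet_Iio, Measure.restrict_restrict measurableSet_Iio,
      Iio_inter_Ioi, ← ofReal_integral_eq_lintegral_ofReal]
    · rw [← integral_Ioc_eq_integral_Ioo, ← intervalIntegral.integral_of_le zero_le_one]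
      norm_num
    · exact (continuous_pow 2).integrableOn_Icc.mono_set Ioo_subset_Icc_self
    · exact ae_of_all _ fun _ => by positivity
  have hleft : ∫⁻ y : Space, H (inner ℝ e y) ‖y‖ = ENNReal.ofReal (1 / 3) *
      ∫⁻ n : Metric.sphere (0 : Space) 1, g (angle (n : Space) e)
        ∂(volume : Measure Space).toSphere := by
    have hmp := (volume : Measure Space).measurePreserving_homeomorphUnitSphereProd
    have hc : ∫⁻ y : Space, H (inner ℝ e y) ‖y‖
        = ∫⁻ y : ({0}ᶜ : Set Space), H (inner ℝ e (y : Space)) ‖(y : Space)‖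
            ∂((volume : Measure Space).comap Subtype.val) := by
      rw [lintegral_subtype_comap (measurableSet_singleton _).compl
        (fun y : Space => H (inner ℝ e y) ‖y‖), restrict_compl_singleton]
    have hs : ∀ y : ({0}ᶜ : Set Space), H (inner ℝ e (y : Space)) ‖(y : Space)‖
        = (fun q : Metric.sphere (0 : Space) 1 × Ioi (0 : ℝ) =>
            g (angle (q.1 : Space) e) * (Iio (1 : ℝ)).indicator 1 (q.2 : ℝ))
            (homeomorphUnitSphereProd Space y) := by
      intro y
      have hy : (y : Space) ≠ 0 := y.2
      simp only [homeomorphUnitSphereProd_apply_snd_coe, homeomorphUnitSphereProd_apply_fst_coe]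
      rw [angle_smul_left_of_pos _ _ (by positivity), hang]
      simp only [H, indicator]
      split_ifs <;> simp
    rw [hc]
    simp_rw [hs]
    have hgm : Measurable fun q : Metric.sphere (0 : Space) 1 => g (angle (q : Space) e) := by
      simp_rw [hang]
      refine hg.comp (measurable_arccos.comp ?_)
      fun_prop
    have him : Measurable fun r : Ioi (0 : ℝ) =>
        (Iio (1 : ℝ)).indicator (1 : ℝ → ENNReal) (r : ℝ) :=
      (measurable_one.indicator measurableSet_Iio).comp measurable_subtype_coe
    rw [hmp.lintegral_comp (f := fun q : Metric.sphere (0 : Space) 1 × Ioi (0 : ℝ) =>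
        g (angle (q.1 : Space) e) * (Iio (1 : ℝ)).indicator 1 (q.2 : ℝ))
        ((hgm.comp measurable_fst).mul (him.comp measurable_snd)),
      lintegral_prod_mul hgm.aemeasurable him.aemeasurable, mul_comm]
    congr 1
    have h1 : (fun r : Ioi (0 : ℝ) => (Iio (1 : ℝ)).indicator (1 : ℝ → ENNReal) (r : ℝ))
        = (Iio (⟨1, mem_Ioi.2 one_pos⟩ : Ioi (0 : ℝ))).indicator 1 := by
      ext r; simp only [indicator]; rfl
    rw [h1, lintegral_indicator_one measurableSet_Iio]
    simp only [finrank_euclideanSpace, Fintype.card_fin]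
    rw [Measure.volumeIoiPow_apply_Iio]
    norm_num
  have hright : ∫⁻ y : Space, H (inner ℝ e y) ‖y‖ = ENNReal.ofReal (2 * π) *
      (ENNReal.ofReal (1 / 3) * ∫⁻ θ in Ioo 0 π, ENNReal.ofReal (sin θ) * g θ) := by
    rw [lintegral_inner_norm he H hH, lintegral_fst_norm H hH]
    congr 1
    -- Nonpositive angles contribute nothing, because `ENNReal.ofReal` sends their nonpositive sine
    -- to 0.
    have hθ : ∫⁻ θ in Ioo (-π) π, ENNReal.ofReal (sin θ) * g (arccos (cos θ))
        = ∫⁻ θ in Ioo 0 π, ENNReal.ofReal (sin θ) * g θ := by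
      rw [← lintegral_indicator measurableSet_Ioo, ← lintegral_indicator measurableSet_Ioo]
      refine lintegral_congr fun θ => ?_
      by_cases h : θ ∈ Ioo 0 π
      · rw [indicator_of_mem h, indicator_of_mem (show θ ∈ Ioo (-π) π from ⟨by linarith [h.1, pi_pos], h.2⟩),
          arccos_cos h.1.le h.2.le]
      · rw [indicator_of_notMem h]
        by_cases h' : θ ∈ Ioo (-π) π
        · rw [indicator_of_mem h', ENNReal.ofReal_of_nonpos, zero_mul]
          have : θ ≤ 0 := by
            by_contra hc
            exact h ⟨not_le.1 hc, h'.2⟩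
          exact sin_nonpos_of_nonpos_of_neg_pi_le this h'.1.le
        · rw [indicator_of_notMem h']
    rw [← hvol, ← hθ, ← lintegral_mul_const]
    swap
    · exact (by fun_prop : Measurable fun ρ : ℝ => ENNReal.ofReal (ρ ^ 2)).indicator
        measurableSet_Iio
    refine setLIntegral_congr_fun measurableSet_Ioi fun ρ hρ => ?_
    rw [← lintegral_const_mul]
    swap
    · exact (by fun_prop : Measurable fun θ : ℝ => ENNReal.ofReal (sin θ)).mul
        (hg.comp (by fun_prop))
    refine lintegral_congr fun θ => ?_
    have hρ' : (0 : ℝ) < ρ := hρ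
    simp only [H, indicator]
    split_ifs
    · rw [mul_div_cancel_left₀ _ hρ'.ne', ENNReal.ofReal_mul hρ'.le, pow_two,
        ENNReal.ofReal_mul hρ'.le]
      ring
    · simp
  rw [hleft, mul_left_comm] at hright
  exact (ENNReal.mul_right_inj (by simp) ENNReal.ofReal_ne_top).1 hright

theorem measurable_smul_sphere (R : ℝ) :
    Measurable fun n : Metric.sphere (0 : Space) 1 => R • (n : Space) := by
  fun_prop

open InnerProductGeometry Set Real in
theorem lintegral_sphereArea_angle {R : ℝ} (hR : 0 < R) {x : Space} (hx : x ≠ 0)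
    {g : ℝ → ENNReal} (hg : Measurable g) :
    ∫⁻ u, g (angle u x) ∂(sphereArea R)
      = ENNReal.ofReal (2 * π * R ^ 2) * ∫⁻ θ in Ioo 0 π, ENNReal.ofReal (sin θ) * g θ := by
  have hm : Measurable fun u : Space => g (angle u x) := by
    unfold angle; fun_prop
  rw [sphereArea, lintegral_smul_measure, lintegral_map hm (measurable_smul_sphere R)]
  have he : ‖(‖x‖⁻¹ • x)‖ = 1 := norm_smul_inv_norm (𝕜 := ℝ) hx
  have h : ∀ n : Metric.sphere (0 : Space) 1, angle (R • (n : Space)) x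
      = angle (n : Space) (‖x‖⁻¹ • x) := fun n => by
    rw [angle_smul_left_of_pos _ _ hR, angle_smul_right_of_pos _ _ (by positivity)]
  simp_rw [h]
  rw [lintegral_toSphere_angle he hg, smul_eq_mul, ← mul_assoc,
    ← ENNReal.ofReal_mul (by positivity), mul_comm (R ^ 2)]

open Set Real in
theorem lintegral_sin : ∫⁻ θ in Ioo 0 π, ENNReal.ofReal (sin θ) = 2 := by
  rw [← ofReal_integral_eq_lintegral_ofReal]
  · rw [← integral_Ioc_eq_integral_Ioo, ← intervalIntegral.integral_of_le pi_pos.le, integral_sin]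
    norm_num
  · exact continuous_sin.integrableOn_Icc.mono_set Ioo_subset_Icc_self
  · filter_upwards [ae_restrict_mem measurableSet_Ioo] with θ hθ
    exact (sin_pos_of_mem_Ioo hθ).le

theorem sphereArea_univ {R : ℝ} (hR : 0 < R) :
    sphereArea R Set.univ = ENNReal.ofReal (4 * Real.pi * R ^ 2) := by
  have hx : (EuclideanSpace.single (0 : Fin 3) (1 : ℝ) : Space) ≠ 0 := by simp
  have := lintegral_sphereArea_angle hR hx (g := fun _ => 1) measurable_const
  simp only [lintegral_const, one_mul, mul_one, lintegral_sin] at this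
  rw [this, show (2 : ENNReal) = ENNReal.ofReal 2 by simp, ← ENNReal.ofReal_mul (by positivity)]
  congr 1; ring

theorem isFiniteMeasure_sphereArea {R : ℝ} (hR : 0 < R) : IsFiniteMeasure (sphereArea R) :=
  ⟨by rw [sphereArea_univ hR]; exact ENNReal.ofReal_lt_top⟩

theorem ae_norm_eq_sphereArea {R : ℝ} (hR : 0 < R) : ∀ᵐ u ∂(sphereArea R), ‖u‖ = R := by
  refine Measure.ae_smul_measure ?_ _
  rw [ae_map_iff (measurable_smul_sphere R).aemeasurable
    (measurableSet_eq_fun (by fun_prop) (by fun_prop))]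
  refine ae_of_all _ fun n => ?_
  rw [norm_smul, mem_sphere_zero_iff_norm.1 n.2, mul_one, Real.norm_of_nonneg hR.le]

theorem ae_norm_eq_sphereUniform {R : ℝ} (hR : 0 < R) : ∀ᵐ u ∂(sphereUniform R), ‖u‖ = R :=
  Measure.ae_smul_measure (ae_norm_eq_sphereArea hR) _

open InnerProductGeometry Set Real in
theorem lintegral_sphereUniform_angle {R : ℝ} (hR : 0 < R) {x : Space} (hx : x ≠ 0)
    {g : ℝ → ENNReal} (hg : Measurable g) :
    ∫⁻ u, g (angle u x) ∂(sphereUniform R)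
      = ∫⁻ θ in Ioo 0 π, ENNReal.ofReal (sin θ / 2) * g θ := by
  rw [sphereUniform, lintegral_smul_measure, lintegral_sphereArea_angle hR hx hg,
    sphereArea_univ hR, smul_eq_mul, ← mul_assoc, ← ENNReal.ofReal_inv_of_pos (by positivity),
    ← ENNReal.ofReal_mul (by positivity), ← lintegral_const_mul _ (by fun_prop)]
  refine lintegral_congr fun θ => ?_
  rw [← mul_assoc, ← ENNReal.ofReal_mul (by positivity)]
  congr 2
  field_simp
  ring

open InnerProductGeometry Set Real in
theorem integral_sphereArea_angle {R : ℝ} (hR : 0 < R) {x : Space} (hx : x ≠ 0)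
    {g : ℝ → ℝ} (hg : Measurable g) (hg0 : ∀ θ, 0 ≤ g θ) :
    ∫ u, g (angle u x) ∂(sphereArea R) = 2 * π * R ^ 2 * ∫ θ in Ioo 0 π, sin θ * g θ := by
  have hm : Measurable fun u : Space => g (angle u x) := by
    unfold angle; fun_prop
  rw [integral_eq_lintegral_of_nonneg_ae (ae_of_all _ fun u => hg0 _) hm.aestronglyMeasurable,
    lintegral_sphereArea_angle hR hx (g := fun θ => ENNReal.ofReal (g θ)) (by fun_prop),
    integral_eq_lintegral_of_nonneg_ae _ (by fun_prop), ENNReal.toReal_mul,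
    ENNReal.toReal_ofReal (by positivity)]
  · congr 2
    refine setLIntegral_congr_fun measurableSet_Ioo fun θ hθ => ?_
    rw [ENNReal.ofReal_mul (sin_pos_of_mem_Ioo hθ).le]
  · filter_upwards [ae_restrict_mem measurableSet_Ioo] with θ hθ
    exact mul_nonneg (sin_pos_of_mem_Ioo hθ).le (hg0 θ)

/-! ### The nearest of independent uniform points -/

open Set Real in
theorem lintegral_half_sin_Ioi {t : ℝ} (ht : t ∈ Ioo 0 π) :
    ∫⁻ θ in Ioo 0 π, ENNReal.ofReal (sin θ / 2) * (Ioi t).indicator 1 θ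
      = ENNReal.ofReal ((1 + cos t) / 2) := by
  have h : ∀ θ, ENNReal.ofReal (sin θ / 2) * (Ioi t).indicator 1 θ
      = (Ioi t).indicator (fun θ => ENNReal.ofReal (sin θ / 2)) θ := fun θ => by
    simp only [indicator]; split_ifs <;> simp
  simp_rw [h]
  rw [lintegral_indicator measurableSet_Ioi, Measure.restrict_restrict measurableSet_Ioi,
    Ioi_inter_Ioo, max_eq_left ht.1.le, ← ofReal_integral_eq_lintegral_ofReal]
  · rw [← integral_Ioc_eq_integral_Ioo, ← intervalIntegral.integral_of_le ht.2.le,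
      intervalIntegral.integral_div, integral_sin, cos_pi]
    congr 1; ring
  · exact (continuous_sin.div_const 2).integrableOn_Icc.mono_set Ioo_subset_Icc_self
  · filter_upwards [ae_restrict_mem measurableSet_Ioo] with θ hθ
    exact div_nonneg (sin_pos_of_mem_Ioo ⟨ht.1.trans hθ.1, hθ.2⟩).le (by norm_num)

open Set Real in
/-- The law of the smallest of independent angles of uniform points on the sphere. -/
theorem lintegral_indicator_nearest {Ω : Type*} [MeasurableSpace Ω] {μ : Measure Ω}
    [IsProbabilityMeasure μ] {N : ℕ} {X : Fin N → Ω → ℝ} (hX : ∀ i, Measurable (X i))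
    (hind : iIndepFun X μ)
    (hlaw : ∀ i (g : ℝ → ENNReal), Measurable g →
      ∫⁻ ω, g (X i ω) ∂μ = ∫⁻ θ in Ioo 0 π, ENNReal.ofReal (sin θ / 2) * g θ)
    (j : Fin N) {φ : ℝ → ENNReal} (hφ : Measurable φ) :
    ∫⁻ ω, {ω | ∀ i, i ≠ j → X j ω < X i ω}.indicator (fun ω => φ (X j ω)) ω ∂μ
      = ∫⁻ θ in Ioo 0 π, ENNReal.ofReal (sin θ / 2 * ((1 + cos θ) / 2) ^ (N - 1)) * φ θ := by
  classical
  let s : Finset (Fin N) := Finset.univ.erase j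
  let T : Set (ℝ × (s → ℝ)) := {q | ∀ i, q.1 < q.2 i}
  have hT : MeasurableSet T := by
    have : T = ⋂ i, {q : ℝ × (s → ℝ) | q.1 < q.2 i} := by ext q; simp [T]
    rw [this]
    exact MeasurableSet.iInter fun i => measurableSet_lt (by fun_prop) (by fun_prop)
  have hd : Disjoint {j} s := by simp [s]
  -- Disjoint sets of indices give independent families: the jth angle against all the others
  -- jointly.
  have hi : IndepFun (X j) (fun ω (i : s) => X i ω) μ :=
    (hind.indepFun_finset {j} s hd hX).comp
      (measurable_pi_apply (⟨j, Finset.mem_singleton_self j⟩ : ({j} : Finset (Fin N))))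
      measurable_id
  -- The common tail stays an integral so as to be measurable on the whole line; its closed form is
  -- needed on (0, π) only.
  let ρ : ℝ → ENNReal := fun t =>
    ∫⁻ θ in Ioo 0 π, ENNReal.ofReal (sin θ / 2) * (Ioi t).indicator 1 θ
  have hρ : Measurable ρ := by
    refine Measurable.lintegral_prod_right' (f := fun q : ℝ × ℝ =>
      ENNReal.ofReal (sin q.2 / 2) * (Ioi q.1).indicator 1 q.2) ?_
    have : (fun q : ℝ × ℝ => ENNReal.ofReal (sin q.2 / 2) * (Ioi q.1).indicator 1 q.2)
        = {q : ℝ × ℝ | q.1 < q.2}.indicator fun q => ENNReal.ofReal (sin q.2 / 2) := by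
      ext q; simp only [indicator, mem_Ioi, Set.mem_ofPred_eq]; split_ifs <;> simp
    rw [this]
    exact Measurable.indicator (by fun_prop) (measurableSet_lt measurable_fst measurable_snd)
  have hρX : ∀ i t, μ (X i ⁻¹' Ioi t) = ρ t := fun i t => by
    simp only [ρ]
    rw [← hlaw i _ (measurable_one.indicator measurableSet_Ioi),
      ← lintegral_indicator_one (hX i measurableSet_Ioi)]
    rfl
  have hprob : ∀ t, μ {ω | ∀ i : s, t < X i ω} = ρ t ^ (N - 1) := fun t => by
    have h1 : {ω | ∀ i : s, t < X i ω} = ⋂ i ∈ s, X i ⁻¹' Ioi t := by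
      ext ω; simp
    rw [h1, hind.measure_inter_preimage_eq_mul s fun i _ => measurableSet_Ioi]
    simp_rw [hρX]
    rw [Finset.prod_const, Finset.card_erase_of_mem (Finset.mem_univ j), Finset.card_univ,
      Fintype.card_fin]
  have hint : ∀ ω, {ω | ∀ i, i ≠ j → X j ω < X i ω}.indicator (fun ω => φ (X j ω)) ω
      = T.indicator (fun q => φ q.1) (X j ω, fun i : s => X i ω) := fun ω => by
    simp only [indicator, T, Set.mem_ofPred_eq]
    congr 1
    simp [s]
  simp_rw [hint]
  rw [lintegral_comp_of_indepFun (hX j) (measurable_pi_lambda (fun ω (i : s) => X i ω) fun i => hX i) hi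
    (f := fun x z => T.indicator (fun q => φ q.1) (x, z))
    ((hφ.comp measurable_fst).indicator hT)]
  have hin : ∀ ω, ∫⁻ ω', T.indicator (fun q => φ q.1) (X j ω, fun i : s => X i ω') ∂μ
      = φ (X j ω) * ρ (X j ω) ^ (N - 1) := fun ω => by
    rw [← hprob, ← lintegral_indicator_const]
    · rfl
    · have : {ω' | ∀ i : s, X j ω < X i ω'}
          = (fun ω' => (X j ω, fun i : s => X i ω')) ⁻¹' T := rfl
      rw [this]
      exact (measurable_const.prodMk (measurable_pi_lambda _ fun i : s => hX i)) hT
  simp_rw [hin]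
  rw [hlaw j (fun t => φ t * ρ t ^ (N - 1)) (hφ.mul (hρ.pow_const _))]
  refine setLIntegral_congr_fun measurableSet_Ioo fun θ hθ => ?_
  have hs := sin_pos_of_mem_Ioo hθ
  have hc : 0 ≤ (1 + cos θ) / 2 := by linarith [neg_one_le_cos θ]
  simp only [ρ]
  rw [lintegral_half_sin_Ioi hθ, ENNReal.ofReal_mul (by positivity), ENNReal.ofReal_pow hc]
  ring

/-! ### Link geometry and the transform of the interference -/

namespace Network

variable {K : ℕ} (net : Network K) (m : Fin K)

theorem orbitRadius_pos : 0 < net.orbitRadius m :=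
  add_pos (net.altitude_pos m) net.earthRadius_pos

theorem earthRadius_lt_orbitRadius : net.earthRadius < net.orbitRadius m := by
  have := net.altitude_pos m
  unfold orbitRadius; linarith

theorem noise_pos : 0 < net.noise := mul_pos net.noiseDensity_pos net.bandwidth_pos

theorem norm_typicalDevice : ‖net.typicalDevice‖ = net.earthRadius := by
  rw [EuclideanSpace.norm_eq, Fin.sum_univ_three]
  simp [typicalDevice, Real.sqrt_sq net.earthRadius_pos.le]

theorem typicalDevice_ne_zero : net.typicalDevice ≠ 0 := by
  rw [← norm_pos_iff, norm_typicalDevice]; exact net.earthRadius_pos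

theorem ratio_pos : 0 < net.earthRadius / net.orbitRadius m :=
  div_pos net.earthRadius_pos (net.orbitRadius_pos m)

theorem ratio_lt_one : net.earthRadius / net.orbitRadius m < 1 :=
  (div_lt_one (net.orbitRadius_pos m)).2 (net.earthRadius_lt_orbitRadius m)

/-- For a narrow beam, sin(beam) < R/R_m for the radii R of the Earth and R_m of the orbit. So
(R_m/R) sin(beam) lies strictly between sin(beam) and 1, inside the domain where arcsine increases.
-/
theorem thetaMax_pos : 0 < net.thetaMax m := by
  have hR := net.earthRadius_pos
  have hm := net.orbitRadius_pos m
  have hlt := net.earthRadius_lt_orbitRadius m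
  have hb := net.beam_pos
  have hr1 := net.ratio_lt_one m
  unfold thetaMax
  split_ifs with h
  · have hπ := Real.arcsin_le_pi_div_two (net.earthRadius / net.orbitRadius m)
    have hs : 0 < Real.sin net.beam :=
      Real.sin_pos_of_pos_of_lt_pi hb (by linarith [Real.pi_pos])
    have h1 : Real.sin net.beam < net.earthRadius / net.orbitRadius m :=
      (Real.lt_arcsin_iff_sin_lt ⟨by linarith [Real.pi_pos], by linarith⟩
        ⟨by linarith [net.ratio_pos m], hr1.le⟩).1 h
    rw [sub_pos, Real.lt_arcsin_iff_sin_lt ⟨by linarith [Real.pi_pos], by linarith⟩]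
    · rw [lt_mul_iff_one_lt_left hs]
      exact (one_lt_div hR).2 hlt
    · constructor
      · have : 0 < net.orbitRadius m / net.earthRadius * Real.sin net.beam := by positivity
        linarith
      · rw [lt_div_iff₀ hm] at h1
        rw [div_mul_eq_mul_div, div_le_one hR]
        linarith
  · exact Real.arccos_pos.2 hr1

theorem thetaMax_lt_pi : net.thetaMax m < Real.pi := by
  have hb := net.beam_pos
  unfold thetaMax
  split_ifs with h
  · linarith [Real.arcsin_le_pi_div_two
      (net.orbitRadius m / net.earthRadius * Real.sin net.beam), Real.pi_pos]
  · linarith [Real.arccos_le_pi_div_two.2 (net.ratio_pos m).le, Real.pi_pos]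

theorem linkDistance_radicand_pos (θ : ℝ) : 0 < net.earthRadius ^ 2 + net.orbitRadius m ^ 2
    - 2 * net.earthRadius * net.orbitRadius m * Real.cos θ := by
  have h1 := mul_pos net.earthRadius_pos (net.orbitRadius_pos m)
  have h2 := net.earthRadius_lt_orbitRadius m
  -- The radicand is at least the square of the difference of the radii.
  nlinarith [Real.cos_le_one θ, mul_pos (sub_pos.2 h2) (sub_pos.2 h2)]

theorem linkDistance_pos (θ : ℝ) : 0 < net.linkDistance m θ :=
  Real.sqrt_pos.2 (net.linkDistance_radicand_pos m θ)

theorem continuous_linkDistance : Continuous (net.linkDistance m) := by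
  unfold linkDistance; fun_prop

theorem dist_eq_linkDistance {u x : Space} (hu : ‖u‖ = net.earthRadius)
    (hx : ‖x‖ = net.orbitRadius m) :
    dist u x = net.linkDistance m (InnerProductGeometry.angle u x) := by
  rw [linkDistance, dist_eq_norm, eq_comm, Real.sqrt_eq_iff_eq_sq
    (net.linkDistance_radicand_pos m _).le (norm_nonneg _), norm_sub_sq_real,
    ← InnerProductGeometry.cos_angle_mul_norm_mul_norm, hu, hx]
  ring

/-- This lets the nearest satellite be recognised by its central angle. -/
theorem linkDistance_lt {s t : ℝ} (hs : 0 ≤ s) (ht : t ≤ Real.pi) (hst : s < t) :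
    net.linkDistance m s < net.linkDistance m t := by
  have h1 := mul_pos net.earthRadius_pos (net.orbitRadius_pos m)
  refine Real.sqrt_lt_sqrt (net.linkDistance_radicand_pos m s).le ?_
  nlinarith [Real.cos_lt_cos_of_nonneg_of_le_pi hs ht hst]

theorem contactPDF_nonneg {θ : ℝ} (hθ : θ ∈ Set.Ioo 0 Real.pi) : 0 ≤ net.contactPDF m θ := by
  have hs := (Real.sin_pos_of_mem_Ioo hθ).le
  have hc : 0 ≤ (1 + Real.cos θ) / 2 := by linarith [Real.neg_one_le_cos θ]
  unfold contactPDF; positivity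

theorem continuous_contactPDF : Continuous (net.contactPDF m) := by
  unfold contactPDF; fun_prop

/-- An antiderivative is -((1 + cos θ)/2)^N. The case b = π gives total mass 1, the case b =
`thetaMax` the availability. -/
theorem lintegral_contactPDF {b : ℝ} (hb : 0 ≤ b) (hbπ : b ≤ Real.pi) :
    ∫⁻ θ in Set.Ioo 0 b, ENNReal.ofReal (net.contactPDF m θ)
      = ENNReal.ofReal (1 - ((1 + Real.cos b) / 2) ^ net.numSat m) := by
  rw [← ofReal_integral_eq_lintegral_ofReal]
  · rw [← integral_Ioc_eq_integral_Ioo, ← intervalIntegral.integral_of_le hb,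
      intervalIntegral.integral_eq_sub_of_hasDerivAt
        (f := fun θ => -((1 + Real.cos θ) / 2) ^ net.numSat m)]
    · simp only [Real.cos_zero]
      congr 1; norm_num; ring
    · intro θ _
      convert! ((((Real.hasDerivAt_cos θ).const_add 1).div_const 2).pow (net.numSat m)).neg using 1
      unfold contactPDF; ring
    · exact (net.continuous_contactPDF m).intervalIntegrable _ _
  · exact (net.continuous_contactPDF m).integrableOn_Icc.mono_set Set.Ioo_subset_Icc_self
  · filter_upwards [ae_restrict_mem measurableSet_Ioo] with θ hθ
    exact net.contactPDF_nonneg m ⟨hθ.1, hθ.2.trans_le hbπ⟩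

/-- The factor by which interference plus noise is multiplied to give the least fading power of
the typical device for which it is covered. -/
def thresholdScale (θ : ℝ) : ℝ :=
  net.β / (net.γ * net.power * net.gain) *
    (4 * Real.pi * net.freq * net.linkDistance m θ / net.c) ^ 2

theorem sLS_eq (θ : ℝ) : net.sLS m θ = net.fadingRate * net.thresholdScale m θ := by
  unfold sLS thresholdScale; ring

theorem fadingRate_pos : 0 < net.fadingRate :=
  div_pos (Real.rpow_pos_of_pos (by exact_mod_cast net.m₁.factorial_pos) _) net.m₂_pos

theorem thresholdScale_pos (θ : ℝ) : 0 < net.thresholdScale m θ := by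
  have := net.β_pos; have := net.γ_pos; have := net.power_pos; have := net.gain_pos
  have := net.freq_pos; have := net.c_pos; have := net.linkDistance_pos m θ
  unfold thresholdScale; positivity

theorem continuous_thresholdScale : Continuous (net.thresholdScale m) := by
  have := net.continuous_linkDistance m
  unfold thresholdScale; fun_prop

theorem continuous_sLS : Continuous (net.sLS m) := by
  have := net.continuous_linkDistance m
  unfold sLS; fun_prop

theorem sLS_pos (θ : ℝ) : 0 < net.sLS m θ := by
  rw [sLS_eq]; exact mul_pos net.fadingRate_pos (net.thresholdScale_pos m θ)

/-- Linearity in the fading puts the interference in the form of a marked Poisson sum. -/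
theorem receivedPower_eq_mul (u x : Space) (g : ℝ) :
    net.receivedPower m u x g = net.receivedPower m u x 1 * g := by
  unfold receivedPower; split_ifs <;> ring

theorem receivedPower_nonneg (u x : Space) {g : ℝ} (hg : 0 ≤ g) :
    0 ≤ net.receivedPower m u x g := by
  have := net.power_pos; have := net.gain_pos
  unfold receivedPower; split_ifs <;> positivity

theorem measurable_receivedPower :
    Measurable fun q : Space × Space => net.receivedPower m q.1 q.2 1 := by
  unfold receivedPower InnerProductGeometry.angle
  refine Measurable.ite (measurableSet_lt ?_ measurable_const) ?_ measurable_const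
  · fun_prop
  · fun_prop

/-- On the surface of the Earth the integrand is a function of the central angle to x, and it
vanishes from `thetaMax` on, where no power is received. Dividing by the rate `1 / m₂` produces the
factor `m₂`. -/
theorem exp_neg_integral_eq_interferenceLT (x : Space) (hx : ‖x‖ = net.orbitRadius m) {s : ℝ}
    (hs : 0 ≤ s) :
    Real.exp (-∫ u, (1 - (1 + s * net.receivedPower m u x 1 / (1 / net.m₂)) ^ (-(net.m₁ : ℤ)))
      ∂(ENNReal.ofReal net.density • sphereArea net.earthRadius)) = net.interferenceLT m s := by
  have hR := net.earthRadius_pos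
  have hx0 : x ≠ 0 := by rw [← norm_pos_iff, hx]; exact net.orbitRadius_pos m
  have := net.m₂_pos; have := net.power_pos; have := net.gain_pos
  let w : ℝ → ℝ := fun θ => 1 - (1 + net.m₂ * s * net.power * net.gain *
          (net.c / (4 * Real.pi * net.freq * net.linkDistance m θ)) ^ 2) ^ (-(net.m₁ : ℤ))
  have hw0 : ∀ θ, 0 ≤ w θ := fun θ => by
    refine sub_nonneg.2 (zpow_le_one_of_nonpos₀ ?_ (by simp))
    have : 0 ≤ net.m₂ * s * net.power * net.gain *
          (net.c / (4 * Real.pi * net.freq * net.linkDistance m θ)) ^ 2 := by positivity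
    linarith
  have hwm : Measurable w := by
    have := (net.continuous_linkDistance m).measurable
    simp only [w, zpow_neg, zpow_natCast]
    fun_prop
  have hae : ∀ᵐ u ∂(sphereArea net.earthRadius),
      (1 - (1 + s * net.receivedPower m u x 1 / (1 / net.m₂)) ^ (-(net.m₁ : ℤ)))
      = (Set.Iio (net.thetaMax m)).indicator w (InnerProductGeometry.angle u x) := by
    filter_upwards [ae_norm_eq_sphereArea hR] with u hu
    unfold receivedPower
    simp only [Set.indicator, Set.mem_Iio]
    split_ifs
    · rw [net.dist_eq_linkDistance m hu hx]
      simp only [w]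
      congr 2
      field_simp
    · simp
  rw [integral_smul_measure, ENNReal.toReal_ofReal net.density_pos.le, smul_eq_mul,
    integral_congr_ae hae, integral_sphereArea_angle hR hx0
      (g := (Set.Iio (net.thetaMax m)).indicator w) (hwm.indicator measurableSet_Iio)
      (Set.indicator_nonneg fun θ _ => hw0 θ), interferenceLT]
  congr 3
  -- The azimuthal integral has a constant integrand and yields the factor 2π of the sphere formula.
  rw [intervalIntegral.integral_const, smul_eq_mul, sub_zero, mul_assoc (2 * Real.pi)]
  congr 1
  rw [intervalIntegral.integral_of_le (net.thetaMax_pos m).le, integral_Ioc_eq_integral_Ioo,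
    ← integral_const_mul]
  have h1 : ∀ θ, net.earthRadius ^ 2 * (Real.sin θ * (Set.Iio (net.thetaMax m)).indicator w θ)
      = (Set.Iio (net.thetaMax m)).indicator
        (fun θ => w θ * (net.earthRadius ^ 2 * Real.sin θ)) θ := fun θ => by
    simp only [Set.indicator]; split_ifs <;> ring
  simp_rw [h1]
  rw [integral_indicator measurableSet_Iio, Measure.restrict_restrict measurableSet_Iio,
    Set.inter_comm, Set.Ioo_inter_Iio, min_eq_right (net.thetaMax_lt_pi m).le]

theorem interferenceLT_pos (s : ℝ) : 0 < net.interferenceLT m s := Real.exp_pos _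

theorem measurable_interferenceLT : Measurable (net.interferenceLT m) := by
  unfold interferenceLT
  simp only [intervalIntegral.integral_const]
  refine Real.measurable_exp.comp (Measurable.neg (Measurable.const_mul
    (Measurable.const_smul (c := 2 * Real.pi - 0) ?_) _))
  simp only [intervalIntegral.integral_of_le (net.thetaMax_pos m).le]
  refine StronglyMeasurable.measurable (StronglyMeasurable.integral_prod_right'
    (f := fun q : ℝ × ℝ => (1 - (1 + net.m₂ * q.1 * net.power * net.gain *
          (net.c / (4 * Real.pi * net.freq * net.linkDistance m q.2)) ^ 2) ^ (-(net.m₁ : ℤ)))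
        * (net.earthRadius ^ 2 * Real.sin q.2)) (Measurable.stronglyMeasurable ?_))
  have := (net.continuous_linkDistance m).measurable
  simp only [zpow_neg, zpow_natCast]
  fun_prop

end Network

/-! ### Events and thresholds as functions of the configuration -/

namespace Network

variable {K : ℕ} (net : Network K) (m : Fin K)

/-- The satellite configurations in which satellite `j` is seen at the strictly smallest central
angle from the typical device. -/
def nearestSet (j : Fin (net.numSat m)) : Set (Fin (net.numSat m) → Space) :=
  {x | ∀ i, i ≠ j → InnerProductGeometry.angle net.typicalDevice (x j)
    < InnerProductGeometry.angle net.typicalDevice (x i)}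

/-- The satellite configurations in which satellite `j` is the nearest one and is linked to the
typical device. -/
def linkedSet (j : Fin (net.numSat m)) : Set (Fin (net.numSat m) → Space) :=
  net.nearestSet m j ∩
    {x | InnerProductGeometry.angle net.typicalDevice (x j) < net.thetaMax m}

theorem measurable_angle_typicalDevice :
    Measurable fun x : Space => InnerProductGeometry.angle net.typicalDevice x := by
  unfold InnerProductGeometry.angle; fun_prop

theorem measurableSet_nearestSet (j : Fin (net.numSat m)) :
    MeasurableSet (net.nearestSet m j) := by
  have h : net.nearestSet m j = ⋂ i, ⋂ (_ : i ≠ j), {x |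
      InnerProductGeometry.angle net.typicalDevice (x j)
        < InnerProductGeometry.angle net.typicalDevice (x i)} := by
    ext x; simp [nearestSet]
  rw [h]
  exact MeasurableSet.iInter fun i => MeasurableSet.iInter fun _ => measurableSet_lt
    (net.measurable_angle_typicalDevice.comp (measurable_pi_apply j))
    (net.measurable_angle_typicalDevice.comp (measurable_pi_apply i))

theorem measurableSet_linkedSet (j : Fin (net.numSat m)) :
    MeasurableSet (net.linkedSet m j) :=
  (net.measurableSet_nearestSet m j).inter (measurableSet_lt
    (net.measurable_angle_typicalDevice.comp (measurable_pi_apply j)) measurable_const)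

theorem eq_of_mem_nearestSet {i j : Fin (net.numSat m)} {x : Fin (net.numSat m) → Space}
    (hi : x ∈ net.nearestSet m i) (hj : x ∈ net.nearestSet m j) : i = j := by
  by_contra h
  exact lt_asymm (hj i h) (hi j (Ne.symm h))

/-- The threshold at satellite `j` as a function of the fading of the interfering devices, of the
satellites and of the devices. -/
def thresholdOf (j : Fin (net.numSat m))
    (w : (ℕ → ℝ) × (Fin (net.numSat m) → Space) × ℕ × (ℕ → Space)) : ℝ :=
  net.thresholdScale m (InnerProductGeometry.angle net.typicalDevice (w.2.1 j)) *
    ((∑ i ∈ Finset.Icc 1 w.2.2.1,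
      net.receivedPower m (w.2.2.2 i) (w.2.1 j) (w.1 (i - 1))) + net.noise)

theorem measurable_thresholdOf (j : Fin (net.numSat m)) : Measurable (net.thresholdOf m j) := by
  have h1 : Measurable fun w : (ℕ → ℝ) × (Fin (net.numSat m) → Space) × ℕ × (ℕ → Space) =>
      net.thresholdScale m (InnerProductGeometry.angle net.typicalDevice (w.2.1 j)) :=
    (net.continuous_thresholdScale m).measurable.comp
      (net.measurable_angle_typicalDevice.comp (by fun_prop))
  refine h1.mul (Measurable.add_const ?_ _)
  refine measurable_comp_nat
    (F := fun N (w : (ℕ → ℝ) × (Fin (net.numSat m) → Space) × ℕ × (ℕ → Space)) =>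
      ∑ i ∈ Finset.Icc 1 N, net.receivedPower m (w.2.2.2 i) (w.2.1 j) (w.1 (i - 1)))
    (fun N => ?_) (by fun_prop)
  refine Finset.measurable_fun_sum _ fun i _ => ?_
  simp_rw [fun w : (ℕ → ℝ) × (Fin (net.numSat m) → Space) × ℕ × (ℕ → Space) =>
    net.receivedPower_eq_mul m (w.2.2.2 i) (w.2.1 j) (w.1 (i - 1))]
  refine Measurable.mul ?_ (by fun_prop)
  exact (net.measurable_receivedPower m).comp
    (f := fun w : (ℕ → ℝ) × (Fin (net.numSat m) → Space) × ℕ × (ℕ → Space) =>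
      (w.2.2.2 i, w.2.1 j)) (by fun_prop)

end Network

/-! ### The law of the threshold at the serving satellite -/

namespace Uplink

variable {K : ℕ} {net : Network K} {m : Fin K} {ν : Measure ℝ}
  {Ω : Type*} [MeasurableSpace Ω] {μ : Measure Ω} (S : Uplink net m ν μ)

/-- The configuration of the satellites. -/
def satConfig (ω : Ω) : Fin (net.numSat m) → Space := fun j => S.sat j ω

/-- The central angle between the typical device and satellite `j`. -/
def contactAngle (j : Fin (net.numSat m)) (ω : Ω) : ℝ :=
  InnerProductGeometry.angle net.typicalDevice (S.sat j ω)

/-- The least fading power of the typical device for which it is covered by satellite `j`. -/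
def threshold (j : Fin (net.numSat m)) (ω : Ω) : ℝ :=
  net.thresholdScale m (S.contactAngle j ω) *
    ((∑ i ∈ Finset.Icc 1 (S.numDev ω),
      net.receivedPower m (S.dev i ω) (S.sat j ω) (S.fading i ω)) + net.noise)

/-- The law of the threshold at the serving satellite, on the event that the typical device is
linked to it. -/
def thresholdMeasure : Measure ℝ :=
  ∑ j, (μ.restrict (S.satConfig ⁻¹' net.linkedSet m j)).map (S.threshold j)

theorem measurable_satConfig : Measurable S.satConfig :=
  measurable_pi_lambda _ S.sat_measurable

theorem measurable_contactAngle (j : Fin (net.numSat m)) : Measurable (S.contactAngle j) :=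
  net.measurable_angle_typicalDevice.comp (S.sat_measurable j)

/-- Everything except the fading of the typical device. -/
def environment (ω : Ω) : (ℕ → ℝ) × (Fin (net.numSat m) → Space) × ℕ × (ℕ → Space) :=
  (fun i => S.fading (i + 1) ω, S.satConfig ω, S.numDev ω, fun i => S.dev i ω)

theorem measurable_devices : Measurable fun ω => (S.numDev ω, fun i => S.dev i ω) :=
  S.dev_poisson.measurable_num.prodMk (measurable_pi_lambda _ S.dev_poisson.measurable_point)

theorem measurable_environment : Measurable S.environment :=
  (measurable_pi_lambda _ fun i => S.fading_measurable (i + 1)).prodMk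
    (S.measurable_satConfig.prodMk S.measurable_devices)

theorem threshold_eq (j : Fin (net.numSat m)) (ω : Ω) :
    S.threshold j ω = net.thresholdOf m j (S.environment ω) := by
  unfold threshold Network.thresholdOf
  congr 2
  refine Finset.sum_congr rfl fun i hi => ?_
  -- The environment omits the fading of device 0, so its fading sequence is shifted by one.
  have : i - 1 + 1 = i := by have := (Finset.mem_Icc.1 hi).1; omega
  simp only [environment, satConfig, this]

theorem measurable_threshold (j : Fin (net.numSat m)) : Measurable (S.threshold j) := by
  have : S.threshold j = net.thresholdOf m j ∘ S.environment := funext (S.threshold_eq j)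
  rw [this]
  exact (net.measurable_thresholdOf m j).comp S.measurable_environment

theorem measurableSet_linked (j : Fin (net.numSat m)) :
    MeasurableSet (S.satConfig ⁻¹' net.linkedSet m j) :=
  S.measurable_satConfig (net.measurableSet_linkedSet m j)

theorem lintegral_thresholdMeasure {f : ℝ → ENNReal} (hf : Measurable f) :
    ∫⁻ t, f t ∂S.thresholdMeasure
      = ∑ j, ∫⁻ ω in S.satConfig ⁻¹' net.linkedSet m j, f (S.threshold j ω) ∂μ := by
  rw [thresholdMeasure, lintegral_finsetSum_measure]
  exact Finset.sum_congr rfl fun j _ => lintegral_map hf (S.measurable_threshold j)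

theorem lintegral_contactAngle (j : Fin (net.numSat m)) {g : ℝ → ENNReal} (hg : Measurable g) :
    ∫⁻ ω, g (S.contactAngle j ω) ∂μ
      = ∫⁻ θ in Set.Ioo 0 Real.pi, ENNReal.ofReal (Real.sin θ / 2) * g θ := by
  rw [← lintegral_sphereUniform_angle (net.orbitRadius_pos m) net.typicalDevice_ne_zero hg]
  have := (S.sat_law j).lintegral_comp
    (f := fun x => g (InnerProductGeometry.angle net.typicalDevice x))
    (hg.comp net.measurable_angle_typicalDevice).aemeasurable
  simp_rw [InnerProductGeometry.angle_comm _ net.typicalDevice]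
  exact this

/-- Each satellite contributes the same integral by symmetry; their number is the factor N in
`contactPDF`. -/
theorem sum_setLIntegral_nearest [IsProbabilityMeasure μ] {φ : ℝ → ENNReal} (hφ : Measurable φ) :
    ∑ j, ∫⁻ ω in S.satConfig ⁻¹' net.nearestSet m j, φ (S.contactAngle j ω) ∂μ
      = ∫⁻ θ in Set.Ioo 0 Real.pi, ENNReal.ofReal (net.contactPDF m θ) * φ θ := by
  have h : ∀ j, ∫⁻ ω in S.satConfig ⁻¹' net.nearestSet m j, φ (S.contactAngle j ω) ∂μ
      = ∫⁻ θ in Set.Ioo 0 Real.pi, ENNReal.ofReal (Real.sin θ / 2 *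
          ((1 + Real.cos θ) / 2) ^ (net.numSat m - 1)) * φ θ := fun j => by
    rw [← lintegral_indicator_nearest S.measurable_contactAngle
      (S.sat_indep.comp (fun _ x => InnerProductGeometry.angle net.typicalDevice x)
        fun _ => net.measurable_angle_typicalDevice)
      (fun i g hg => S.lintegral_contactAngle i hg) j hφ,
      ← lintegral_indicator (S.measurable_satConfig (net.measurableSet_nearestSet m j))]
    rfl
  simp_rw [h]
  rw [Finset.sum_const, Finset.card_univ, Fintype.card_fin, nsmul_eq_mul,
    ← lintegral_const_mul' _ _ (ENNReal.natCast_ne_top _)]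
  refine lintegral_congr fun θ => ?_
  rw [← mul_assoc, ← ENNReal.ofReal_natCast, ← ENNReal.ofReal_mul (by positivity)]
  congr 2
  unfold Network.contactPDF; ring

theorem sum_setLIntegral_linked [IsProbabilityMeasure μ] {φ : ℝ → ENNReal} (hφ : Measurable φ) :
    ∑ j, ∫⁻ ω in S.satConfig ⁻¹' net.linkedSet m j, φ (S.contactAngle j ω) ∂μ
      = ∫⁻ θ in Set.Ioo 0 (net.thetaMax m), ENNReal.ofReal (net.contactPDF m θ) * φ θ := by
  have h : ∀ j, ∫⁻ ω in S.satConfig ⁻¹' net.linkedSet m j, φ (S.contactAngle j ω) ∂μ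
      = ∫⁻ ω in S.satConfig ⁻¹' net.nearestSet m j,
          (Set.Iio (net.thetaMax m)).indicator φ (S.contactAngle j ω) ∂μ := fun j => by
    have h1 : S.satConfig ⁻¹' net.linkedSet m j = S.contactAngle j ⁻¹' Set.Iio (net.thetaMax m) ∩
        S.satConfig ⁻¹' net.nearestSet m j := Set.inter_comm _ _
    have hm := S.measurable_contactAngle j (measurableSet_Iio (a := net.thetaMax m))
    rw [h1, ← Measure.restrict_restrict hm, ← lintegral_indicator hm]
    rfl
  simp_rw [h]
  rw [S.sum_setLIntegral_nearest (hφ.indicator measurableSet_Iio)]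
  have h2 : ∀ θ, ENNReal.ofReal (net.contactPDF m θ) * (Set.Iio (net.thetaMax m)).indicator φ θ
      = (Set.Iio (net.thetaMax m)).indicator
          (fun θ => ENNReal.ofReal (net.contactPDF m θ) * φ θ) θ := fun θ => by
    simp only [Set.indicator]; split_ifs <;> simp
  simp_rw [h2]
  rw [lintegral_indicator measurableSet_Iio, Measure.restrict_restrict measurableSet_Iio,
    Set.inter_comm, Set.Ioo_inter_Iio, min_eq_right (net.thetaMax_lt_pi m).le]

/-- Ties have probability 0: the events of being strictly nearest are disjoint, and their
probabilities add up to the total mass 1 of the contact density. -/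
theorem ae_exists_mem_nearestSet [IsProbabilityMeasure μ] :
    ∀ᵐ ω ∂μ, ∃ j, S.satConfig ω ∈ net.nearestSet m j := by
  have hm : ∀ j, MeasurableSet (S.satConfig ⁻¹' net.nearestSet m j) := fun j =>
    S.measurable_satConfig (net.measurableSet_nearestSet m j)
  have h1 : μ (⋃ j, S.satConfig ⁻¹' net.nearestSet m j) = 1 := by
    rw [measure_iUnion _ hm, tsum_fintype]
    · have := S.sum_setLIntegral_nearest (φ := fun _ => 1) measurable_const
      simp only [lintegral_const, one_mul, mul_one, Measure.restrict_apply MeasurableSet.univ,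
        Set.univ_inter] at this
      rw [this, net.lintegral_contactPDF m Real.pi_pos.le le_rfl]
      simp [(net.numSat_pos m).ne']
    · intro i j hij
      exact Set.disjoint_left.2 fun ω hi hj => hij (net.eq_of_mem_nearestSet m hi hj)
  have := (prob_compl_eq_zero_iff (MeasurableSet.iUnion hm)).2 h1
  filter_upwards [measure_eq_zero_iff_ae_notMem.1 this] with ω hω
  simpa using hω

theorem ae_norm_sat : ∀ᵐ ω ∂μ, ∀ j, ‖S.sat j ω‖ = net.orbitRadius m := by
  rw [ae_all_iff]
  intro j
  have h := ae_norm_eq_sphereUniform (net.orbitRadius_pos m)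
  rw [← (S.sat_law j).map_eq] at h
  exact ae_of_ae_map (S.sat_measurable j).aemeasurable h

theorem ae_fading_nonneg : ∀ᵐ ω ∂μ, ∀ i, i ≠ 0 → 0 ≤ S.fading i ω := by
  rw [ae_all_iff]
  intro i
  by_cases hi : i = 0
  · exact ae_of_all _ fun ω h => absurd hi h
  have h := ae_nonneg_gammaMeasure (net.m₁ : ℝ) (1 / net.m₂)
  rw [← (S.fading_law i hi).map_eq] at h
  filter_upwards [ae_of_ae_map (S.fading_measurable i).aemeasurable h] with ω hω _ using hω

/-- The serving index is any minimiser of the distance, with no measurability assumed; a strictly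
smallest angle determines it. -/
theorem serving_eq {ω : Ω} {j : Fin (net.numSat m)}
    (hn : ∀ j, ‖S.sat j ω‖ = net.orbitRadius m) (hj : S.satConfig ω ∈ net.nearestSet m j) :
    S.serving ω = j := by
  by_contra h
  have h1 := hj _ h
  have h2 := S.serving_nearest ω j
  rw [net.dist_eq_linkDistance m net.norm_typicalDevice (hn _),
    net.dist_eq_linkDistance m net.norm_typicalDevice (hn _)] at h2
  exact absurd h2 (not_le.2 (net.linkDistance_lt m (InnerProductGeometry.angle_nonneg _ _)
    (InnerProductGeometry.angle_le_pi _ _) h1))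

/-- Interference plus noise is positive, so the SINR inequality can be solved for the fading of the
typical device. Without a link the SINR is 0, below the positive threshold. -/
theorem lt_sinr_iff {ω : Ω} {j : Fin (net.numSat m)}
    (hn : ∀ j, ‖S.sat j ω‖ = net.orbitRadius m) (hf : ∀ i, i ≠ 0 → 0 ≤ S.fading i ω)
    (hj : S.satConfig ω ∈ net.nearestSet m j) :
    net.β < S.sinr ω ↔ S.contactAngle j ω < net.thetaMax m ∧ S.threshold j ω < S.fading 0 ω := by
  have hI : 0 ≤ ∑ i ∈ Finset.Icc 1 (S.numDev ω),
      net.receivedPower m (S.dev i ω) (S.sat j ω) (S.fading i ω) :=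
    Finset.sum_nonneg fun i hi => net.receivedPower_nonneg m _ _
      (hf i (by have := (Finset.mem_Icc.1 hi).1; omega))
  have hD := add_pos_of_nonneg_of_pos hI net.noise_pos
  unfold sinr interference power threshold
  rw [S.serving_eq hn hj, S.dev_zero]
  set D := (∑ i ∈ Finset.Icc 1 (S.numDev ω),
      net.receivedPower m (S.dev i ω) (S.sat j ω) (S.fading i ω)) + net.noise
  rw [lt_div_iff₀ hD]
  have := net.β_pos; have := net.γ_pos; have := net.power_pos; have := net.gain_pos
  have := net.freq_pos; have := net.c_pos; have := net.linkDistance_pos m (S.contactAngle j ω)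
  have hβ : 0 < net.β * D := by positivity
  unfold Network.receivedPower
  rw [net.dist_eq_linkDistance m net.norm_typicalDevice (hn j)]
  change net.β * D < net.γ * (if S.contactAngle j ω < net.thetaMax m then
    net.power * (net.c / (4 * Real.pi * net.freq * net.linkDistance m (S.contactAngle j ω))) ^ 2 *
      net.gain * S.fading 0 ω else 0) ↔ _
  split_ifs with h
  · simp only [h, true_and]
    have e : net.thresholdScale m (S.contactAngle j ω) * D = net.β * D / (net.γ * (net.power *
        (net.c / (4 * Real.pi * net.freq * net.linkDistance m (S.contactAngle j ω))) ^ 2 *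
        net.gain)) := by
      unfold Network.thresholdScale; field_simp
    rw [e, div_lt_iff₀ (by positivity)]
    constructor <;> intro h <;> linarith
  · simp only [h, false_and, iff_false, mul_zero]
    exact not_lt.2 hβ.le

theorem indepFun_environment_fading_zero [IsProbabilityMeasure μ] :
    IndepFun S.environment (S.fading 0) μ := by
  have h0 : IndepFun (S.fading 0) (fun ω (i : ℕ) => S.fading (i + 1) ω) μ := by
    rw [IndepFun_iff_Indep]
    have h := indep_iSup_of_disjoint
      (m := fun i => MeasurableSpace.comap (S.fading i) inferInstance)
      (fun i => (S.fading_measurable i).comap_le) S.fading_indep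
      (S := {0}) (T := {0}ᶜ) disjoint_compl_right
    refine indep_of_indep_of_le_left (indep_of_indep_of_le_right h ?_) ?_
    · rw [← measurable_iff_comap_le]
      refine @measurable_pi_lambda _ _ _ (_) _ _ fun i => ?_
      rw [measurable_iff_comap_le]
      exact le_iSup₂_of_le (i + 1) (by simp) le_rfl
    · exact le_iSup₂_of_le 0 (by simp) le_rfl
  have hm : Measurable fun ω (i : ℕ) => S.fading (i + 1) ω :=
    measurable_pi_lambda _ fun i => S.fading_measurable (i + 1)
  refine (indepFun_prodMk_assoc (S.fading_measurable 0) hm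
    (S.measurable_satConfig.prodMk S.measurable_devices) h0 ?_).symm
  exact S.indep_fading.comp
    (φ := fun h : ℕ → ℝ => (h 0, fun i => h (i + 1))) (by fun_prop) measurable_id

/-- Conditioning on the environment, which determines both the linked event and the threshold and is
independent of the fading of the typical device. -/
theorem measure_linked_inter [IsProbabilityMeasure μ] (j : Fin (net.numSat m)) :
    μ (S.satConfig ⁻¹' net.linkedSet m j ∩ {ω | S.threshold j ω < S.fading 0 ω})
      = ∫⁻ ω in S.satConfig ⁻¹' net.linkedSet m j, ν (Set.Ioi (S.threshold j ω)) ∂μ := by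
  let A : Set (((ℕ → ℝ) × (Fin (net.numSat m) → Space) × ℕ × (ℕ → Space)) × ℝ) :=
    (fun q => q.1.2.1) ⁻¹' net.linkedSet m j ∩ {q | net.thresholdOf m j q.1 < q.2}
  have hA : MeasurableSet A :=
    ((by fun_prop : Measurable fun q : ((ℕ → ℝ) × (Fin (net.numSat m) → Space) × ℕ × (ℕ → Space))
      × ℝ => q.1.2.1) (net.measurableSet_linkedSet m j)).inter
      (measurableSet_lt ((net.measurable_thresholdOf m j).comp measurable_fst) measurable_snd)
  have hT : MeasurableSet {ω | S.threshold j ω < S.fading 0 ω} :=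
    measurableSet_lt (S.measurable_threshold j) (S.fading_measurable 0)
  rw [← lintegral_indicator_one ((S.measurableSet_linked j).inter hT)]
  have h1 : ∀ ω, (S.satConfig ⁻¹' net.linkedSet m j ∩
      {ω | S.threshold j ω < S.fading 0 ω}).indicator (1 : Ω → ENNReal) ω
      = A.indicator 1 (S.environment ω, S.fading 0 ω) := fun ω => by
    have h : ω ∈ S.satConfig ⁻¹' net.linkedSet m j ∩ {ω | S.threshold j ω < S.fading 0 ω}
        ↔ (S.environment ω, S.fading 0 ω) ∈ A := by
      change _ ∧ S.threshold j ω < _ ↔ _ ∧ _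
      rw [S.threshold_eq]
      rfl
    by_cases h' : (S.environment ω, S.fading 0 ω) ∈ A
    · rw [Set.indicator_of_mem (h.2 h'), Set.indicator_of_mem h']; rfl
    · rw [Set.indicator_of_notMem (mt h.1 h'), Set.indicator_of_notMem h']
  simp_rw [h1]
  rw [lintegral_comp_of_indepFun S.measurable_environment (S.fading_measurable 0)
    S.indepFun_environment_fading_zero (f := fun w z => A.indicator 1 (w, z))
    (measurable_one.indicator hA), ← lintegral_indicator (S.measurableSet_linked j)]
  refine lintegral_congr fun ω => ?_
  have hν : ν (Set.Ioi (S.threshold j ω)) = μ (S.fading 0 ⁻¹' Set.Ioi (S.threshold j ω)) := by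
    rw [← Measure.map_apply (S.fading_measurable 0) measurableSet_Ioi, S.fading_zero_law.map_eq]
  by_cases h : ω ∈ S.satConfig ⁻¹' net.linkedSet m j
  · rw [Set.indicator_of_mem h, hν, ← lintegral_indicator_one (S.fading_measurable 0 measurableSet_Ioi)]
    refine lintegral_congr fun ω' => ?_
    have h2 : (S.environment ω, S.fading 0 ω') ∈ A ↔ S.threshold j ω < S.fading 0 ω' := by
      rw [S.threshold_eq]
      exact ⟨fun h => h.2, fun h' => ⟨h, h'⟩⟩
    simp only [Set.indicator, h2]
    rfl
  · rw [Set.indicator_of_notMem h]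
    have h2 : ∀ z, (S.environment ω, z) ∉ A := fun z hz => h hz.1
    simp [Set.indicator, h2]

theorem measure_covered [IsProbabilityMeasure μ] [IsProbabilityMeasure ν] :
    μ {ω | net.β < S.sinr ω} = ∫⁻ t, ν (Set.Ioi t) ∂S.thresholdMeasure := by
  have hν : Measurable fun t => ν (Set.Ioi t) :=
    Antitone.measurable fun s t hst => measure_mono (Set.Ioi_subset_Ioi hst)
  rw [S.lintegral_thresholdMeasure hν]
  simp_rw [← S.measure_linked_inter]
  rw [← tsum_fintype (L := SummationFilter.unconditional _), ← measure_iUnion]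
  -- The coverage event need not be measurable; it agrees almost everywhere with a disjoint union of
  -- measurable events.
  · refine measure_congr ?_
    filter_upwards [S.ae_exists_mem_nearestSet, S.ae_norm_sat, S.ae_fading_nonneg]
      with ω ⟨j, hj⟩ hn hf
    refine propext ?_
    change net.β < S.sinr ω ↔ ω ∈ ⋃ i, _
    rw [S.lt_sinr_iff hn hf hj, Set.mem_iUnion]
    constructor
    · exact fun h => ⟨j, ⟨hj, h.1⟩, h.2⟩
    · rintro ⟨i, hi, hT⟩
      obtain rfl := net.eq_of_mem_nearestSet m hi.1 hj
      exact ⟨hi.2, hT⟩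
  · intro i j hij
    exact Set.disjoint_left.2 fun ω hi hj => hij (net.eq_of_mem_nearestSet m hi.1.1 hj.1.1)
  · exact fun j => (S.measurableSet_linked j).inter
      (measurableSet_lt (S.measurable_threshold j) (S.fading_measurable 0))

/-- This mass is the source of the factor `availability` in the error bound. -/
theorem thresholdMeasure_univ [IsProbabilityMeasure μ] :
    S.thresholdMeasure Set.univ = ENNReal.ofReal (net.availability m) := by
  rw [← lintegral_one, S.lintegral_thresholdMeasure measurable_const,
    S.sum_setLIntegral_linked (φ := fun _ => 1) measurable_const]
  simp only [mul_one]
  exact net.lintegral_contactPDF m (net.thetaMax_pos m).le (net.thetaMax_lt_pi m).le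

/-- Explains why the two distribution functions need to be compared on [0, ∞) only. -/
theorem ae_thresholdMeasure_nonneg : ∀ᵐ t ∂S.thresholdMeasure, 0 ≤ t := by
  rw [ae_iff, thresholdMeasure, Measure.coe_finsetSum, Finset.sum_apply]
  refine Finset.sum_eq_zero fun j _ => ?_
  rw [← ae_iff, ae_map_iff (S.measurable_threshold j).aemeasurable measurableSet_Ici]
  refine ae_restrict_of_ae ?_
  filter_upwards [S.ae_fading_nonneg] with ω hf
  refine mul_nonneg (net.thresholdScale_pos m _).le (add_nonneg ?_ net.noise_pos.le)
  exact Finset.sum_nonneg fun i hi => net.receivedPower_nonneg m _ _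
      (hf i (by have := (Finset.mem_Icc.1 hi).1; omega))

/-- Since κ times `thresholdScale` is `sLS`, the exponential splits into a noise factor, fixed by
the satellites, and a product over the devices. The Laplace functional applies with the satellite
configuration as environment. -/
theorem setLIntegral_linked_exp [IsProbabilityMeasure μ] (j : Fin (net.numSat m)) (q : ℕ) :
    ∫⁻ ω in S.satConfig ⁻¹' net.linkedSet m j,
        ENNReal.ofReal (Real.exp (-(q * net.fadingRate * S.threshold j ω))) ∂μ
      = ∫⁻ ω in S.satConfig ⁻¹' net.linkedSet m j,
        ENNReal.ofReal (Real.exp (-(q * net.sLS m (S.contactAngle j ω) * net.noise)) *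
          net.interferenceLT m (q * net.sLS m (S.contactAngle j ω))) ∂μ := by
  have := isFiniteMeasure_sphereArea net.earthRadius_pos
  have hfin : IsFiniteMeasure (ENNReal.ofReal net.density • sphereArea net.earthRadius) :=
    Measure.smul_finite _ ENNReal.ofReal_ne_top
  let θ : (Fin (net.numSat m) → Space) → ℝ := fun x =>
    InnerProductGeometry.angle net.typicalDevice (x j)
  have hθ : Measurable θ := net.measurable_angle_typicalDevice.comp (measurable_pi_apply j)
  have hs : Measurable fun x => net.sLS m (θ x) := (net.continuous_sLS m).measurable.comp hθ
  -- The weight A carries the linked event as well as the noise factor.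
  let A : (Fin (net.numSat m) → Space) → ENNReal := (net.linkedSet m j).indicator fun x =>
    ENNReal.ofReal (Real.exp (-(q * net.sLS m (θ x) * net.noise)))
  have hA : Measurable A :=
    Measurable.indicator (by fun_prop) (net.measurableSet_linkedSet m j)
  let g : (Fin (net.numSat m) → Space) → Space → ℝ := fun x u =>
    q * net.sLS m (θ x) * net.receivedPower m u (x j) 1
  have hg : Measurable (Function.uncurry g) := by
    refine Measurable.mul ?_ ?_
    · have : Measurable fun p : (Fin (net.numSat m) → Space) × Space => net.sLS m (θ p.1) :=
        hs.comp measurable_fst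
      fun_prop
    · exact (net.measurable_receivedPower m).comp
        (f := fun p : (Fin (net.numSat m) → Space) × Space => (p.2, p.1 j)) (by fun_prop)
  have hg0 : ∀ x u, 0 ≤ g x u := fun x u =>
    mul_nonneg (mul_nonneg (by positivity) (net.sLS_pos m _).le)
      (net.receivedPower_nonneg m _ _ zero_le_one)
  have key := lintegral_mul_prod_exp_neg_gamma S.dev_poisson S.measurable_satConfig
    S.fading_measurable net.m₁_pos (one_div_pos.2 net.m₂_pos) S.fading_law S.fading_indep
    S.indep_sat_dev S.indep_fading hA hg hg0
  rw [← lintegral_indicator (S.measurableSet_linked j),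
    ← lintegral_indicator (S.measurableSet_linked j)]
  refine Eq.trans (lintegral_congr fun ω => ?_) (key.trans (lintegral_congr_ae ?_))
  · by_cases h : ω ∈ S.satConfig ⁻¹' net.linkedSet m j
    · rw [Set.indicator_of_mem h]
      simp only [A]
      rw [Set.indicator_of_mem (Set.mem_preimage.1 h), ← ENNReal.ofReal_prod_of_nonneg fun i _ => (Real.exp_pos _).le,
        ← ENNReal.ofReal_mul (Real.exp_pos _).le, ← Real.exp_sum, ← Real.exp_add]
      congr 2
      have e : ∀ i, g (S.satConfig ω) (S.dev i ω) * S.fading i ω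
          = q * net.sLS m (S.contactAngle j ω) *
            net.receivedPower m (S.dev i ω) (S.sat j ω) (S.fading i ω) := fun i => by
        rw [net.receivedPower_eq_mul m _ _ (S.fading i ω)]
        exact mul_assoc _ _ _
      simp_rw [e]
      rw [Finset.sum_neg_distrib, ← Finset.mul_sum, threshold]
      change _ = -(q * net.sLS m (S.contactAngle j ω) * net.noise) + _
      rw [net.sLS_eq]
      ring
    · rw [Set.indicator_of_notMem h]
      simp only [A]
      rw [Set.indicator_of_notMem (mt Set.mem_preimage.2 h), zero_mul]
  · filter_upwards [S.ae_norm_sat] with ω hn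
    have hL := net.exp_neg_integral_eq_interferenceLT m (S.sat j ω) (hn j)
      (s := q * net.sLS m (S.contactAngle j ω))
      (mul_nonneg (by positivity) (net.sLS_pos m _).le)
    change A (S.satConfig ω) * ENNReal.ofReal (Real.exp (-∫ u, (1 - (1 +
      q * net.sLS m (S.contactAngle j ω) * net.receivedPower m u (S.sat j ω) 1 / (1 / net.m₂))
        ^ (-(net.m₁ : ℤ))) ∂(ENNReal.ofReal net.density • sphereArea net.earthRadius))) = _
    rw [hL]
    by_cases h : ω ∈ S.satConfig ⁻¹' net.linkedSet m j
    · rw [Set.indicator_of_mem h]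
      simp only [A]
      rw [Set.indicator_of_mem (Set.mem_preimage.1 h), ← ENNReal.ofReal_mul (Real.exp_pos _).le]
      rfl
    · rw [Set.indicator_of_notMem h]
      simp only [A]
      rw [Set.indicator_of_notMem (mt Set.mem_preimage.2 h), zero_mul]

theorem integral_exp_thresholdMeasure [IsProbabilityMeasure μ] (q : ℕ) :
    ∫ t, Real.exp (-(q * net.fadingRate * t)) ∂S.thresholdMeasure
      = ∫ θ in (0 : ℝ)..(net.thetaMax m),
        Real.exp (-(q * net.sLS m θ * net.noise)) *
          net.interferenceLT m (q * net.sLS m θ) * net.contactPDF m θ := by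
  have hs := (net.continuous_sLS m).measurable
  have hc := (net.continuous_contactPDF m).measurable
  have hLT : Measurable fun θ => net.interferenceLT m (q * net.sLS m θ) :=
    (net.measurable_interferenceLT m).comp (by fun_prop)
  have hφ : Measurable fun θ => ENNReal.ofReal (Real.exp (-(q * net.sLS m θ * net.noise)) *
          net.interferenceLT m (q * net.sLS m θ)) := by fun_prop
  rw [integral_eq_lintegral_of_nonneg_ae (ae_of_all _ fun t => (Real.exp_pos _).le)
    (by fun_prop), S.lintegral_thresholdMeasure (by fun_prop)]
  simp_rw [S.setLIntegral_linked_exp]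
  rw [S.sum_setLIntegral_linked hφ, intervalIntegral.integral_of_le (net.thetaMax_pos m).le,
    integral_Ioc_eq_integral_Ioo, integral_eq_lintegral_of_nonneg_ae]
  · congr 1
    refine setLIntegral_congr_fun measurableSet_Ioo fun θ hθ => ?_
    rw [mul_comm, ENNReal.ofReal_mul (mul_nonneg (Real.exp_pos _).le
      (net.interferenceLT_pos m _).le)]
  · filter_upwards [ae_restrict_mem measurableSet_Ioo] with θ hθ
    exact mul_nonneg (mul_nonneg (Real.exp_pos _).le (net.interferenceLT_pos m _).le)
      (net.contactPDF_nonneg m ⟨hθ.1, hθ.2.trans (net.thetaMax_lt_pi m)⟩)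
  · fun_prop

end Uplink

/-! ### Comparison of the coverage with the closed form -/

theorem one_sub_one_sub_pow (y : ℝ) (n : ℕ) :
    1 - (1 - y) ^ n
      = ∑ q ∈ Finset.Icc 1 n, (n.choose q : ℝ) * (-1) ^ (q + 1) * y ^ q := by
  have h : (1 - y) ^ n = ∑ q ∈ Finset.range (n + 1), (-y) ^ q * (n.choose q : ℝ) := by
    rw [sub_eq_neg_add, add_pow]; simp
  have hs : Finset.range (n + 1) = insert 0 (Finset.Icc 1 n) := by
    ext q; simp only [Finset.mem_range, Finset.mem_insert, Finset.mem_Icc]; omega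
  rw [h, hs, Finset.sum_insert (by simp)]
  simp only [pow_zero, Nat.choose_zero_right, Nat.cast_one, mul_one, sub_add_cancel_left]
  rw [← Finset.sum_neg_distrib]
  refine Finset.sum_congr rfl fun q _ => ?_
  rw [neg_pow]; ring

namespace Network

variable {K : ℕ} (net : Network K) (m : Fin K)

theorem availability_nonneg : 0 ≤ net.availability m := by
  refine sub_nonneg.2 (pow_le_one₀ ?_ ?_)
  · linarith [Real.neg_one_le_cos (net.thetaMax m)]
  · linarith [Real.cos_le_one (net.thetaMax m)]

theorem one_sub_approxCDF (t : ℝ) : 1 - net.approxCDF t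
    = ∑ q ∈ Finset.Icc 1 net.m₁, (net.m₁.choose q : ℝ) * (-1) ^ (q + 1) *
        Real.exp (-(q * net.fadingRate * t)) := by
  rw [approxCDF, one_sub_one_sub_pow]
  refine Finset.sum_congr rfl fun q _ => ?_
  rw [← Real.exp_nat_mul]
  ring_nf

/-- For shape 1 the Gamma law is exponential and κ is its rate, so the approximation is exact. -/
theorem cdf_gammaMeasure_eq_approxCDF (h1 : net.m₁ = 1) {x : ℝ}
    (hx : 0 ≤ x) : cdf (gammaMeasure (net.m₁ : ℝ) (1 / net.m₂)) x = net.approxCDF x := by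
  have h := cdf_expMeasure_eq (one_div_pos.2 net.m₂_pos) x
  rw [expMeasure, if_pos hx] at h
  simp [approxCDF, fadingRate, h1] at h ⊢
  exact h

end Network

namespace Uplink

variable {K : ℕ} {net : Network K} {m : Fin K} {ν : Measure ℝ}
  {Ω : Type*} [MeasurableSpace Ω] {μ : Measure Ω} (S : Uplink net m ν μ)

theorem isFiniteMeasure_thresholdMeasure [IsProbabilityMeasure μ] :
    IsFiniteMeasure S.thresholdMeasure :=
  ⟨by rw [S.thresholdMeasure_univ]; exact ENNReal.ofReal_lt_top⟩

theorem coverage_eq_integral [IsProbabilityMeasure μ] [IsProbabilityMeasure ν] :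
    S.coverage = ∫ t, (1 - cdf ν t) ∂S.thresholdMeasure := by
  rw [integral_eq_lintegral_of_nonneg_ae (ae_of_all _ fun t => sub_nonneg.2 (cdf_le_one ν t))
    (measurable_const.sub (cdf ν).mono.measurable).aestronglyMeasurable, coverage,
    measureReal_def, S.measure_covered]
  congr 1
  refine lintegral_congr fun t => ?_
  rw [cdf_eq_real, ← probReal_compl_eq_one_sub measurableSet_Iic, Set.compl_Iic, ofReal_measureReal]

theorem integrable_exp_thresholdMeasure [IsProbabilityMeasure μ] {b : ℝ} (hb : 0 ≤ b) :
    Integrable (fun t => Real.exp (-(b * t))) S.thresholdMeasure := by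
  have := S.isFiniteMeasure_thresholdMeasure
  refine Integrable.of_bound (C := 1) (by fun_prop) ?_
  filter_upwards [S.ae_thresholdMeasure_nonneg] with t ht
  rw [Real.norm_of_nonneg (Real.exp_pos _).le]
  exact Real.exp_le_one_iff.2 (neg_nonpos.2 (mul_nonneg hb ht))

theorem integrable_one_sub_approxCDF [IsProbabilityMeasure μ] :
    Integrable (fun t => 1 - net.approxCDF t) S.thresholdMeasure := by
  simp_rw [net.one_sub_approxCDF]
  exact integrable_finsetSum _ fun q _ => (S.integrable_exp_thresholdMeasure
    (mul_nonneg q.cast_nonneg net.fadingRate_pos.le)).const_mul _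

/-- The sum over q in the closed form is the binomial expansion of 1 - A, integrated term by term
through the Laplace transform of the threshold law. -/
theorem coverageFormula_eq_integral [IsProbabilityMeasure μ] :
    net.coverageFormula m = ∫ t, (1 - net.approxCDF t) ∂S.thresholdMeasure := by
  simp_rw [net.one_sub_approxCDF]
  rw [integral_finsetSum _ fun q _ => (S.integrable_exp_thresholdMeasure
    (mul_nonneg q.cast_nonneg net.fadingRate_pos.le)).const_mul _]
  refine Finset.sum_congr rfl fun q _ => ?_
  rw [integral_const_mul, S.integral_exp_thresholdMeasure]

theorem integrable_one_sub_cdf [IsProbabilityMeasure μ] :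
    Integrable (fun t => 1 - cdf ν t) S.thresholdMeasure := by
  have := S.isFiniteMeasure_thresholdMeasure
  refine Integrable.of_bound (C := 1)
    (measurable_const.sub (cdf ν).mono.measurable).aestronglyMeasurable (ae_of_all _ fun t => ?_)
  rw [Real.norm_of_nonneg (sub_nonneg.2 (cdf_le_one ν t))]
  linarith [cdf_nonneg ν t]

theorem coverage_le_of_approxCDF_le [IsProbabilityMeasure μ] [IsProbabilityMeasure ν]
    (h : ∀ x, 0 ≤ x → net.approxCDF x ≤ cdf ν x) : S.coverage ≤ net.coverageFormula m := by
  rw [S.coverage_eq_integral, S.coverageFormula_eq_integral]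
  refine integral_mono_ae S.integrable_one_sub_cdf S.integrable_one_sub_approxCDF ?_
  filter_upwards [S.ae_thresholdMeasure_nonneg] with t ht
  linarith [h t ht]

theorem le_coverage_of_cdf_le [IsProbabilityMeasure μ] [IsProbabilityMeasure ν]
    (h : ∀ x, 0 ≤ x → cdf ν x ≤ net.approxCDF x) : net.coverageFormula m ≤ S.coverage := by
  rw [S.coverage_eq_integral, S.coverageFormula_eq_integral]
  refine integral_mono_ae S.integrable_one_sub_approxCDF S.integrable_one_sub_cdf ?_
  filter_upwards [S.ae_thresholdMeasure_nonneg] with t ht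
  linarith [h t ht]

theorem abs_coverage_sub_le [IsProbabilityMeasure μ] [IsProbabilityMeasure ν] {ε : ℝ}
    (h : ∀ x, 0 ≤ x → |cdf ν x - net.approxCDF x| ≤ ε) :
    |S.coverage - net.coverageFormula m| ≤ ε * net.availability m := by
  have := S.isFiniteMeasure_thresholdMeasure
  rw [S.coverage_eq_integral, S.coverageFormula_eq_integral,
    ← integral_sub S.integrable_one_sub_cdf S.integrable_one_sub_approxCDF]
  have hb := norm_integral_le_of_norm_le_const (μ := S.thresholdMeasure) (C := ε)
    (f := fun t => 1 - cdf ν t - (1 - net.approxCDF t)) (by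
      filter_upwards [S.ae_thresholdMeasure_nonneg] with t ht
      rw [Real.norm_eq_abs, ← abs_neg]
      refine le_trans (le_of_eq ?_) (h t ht)
      congr 1; ring)
  rwa [Real.norm_eq_abs, measureReal_def, S.thresholdMeasure_univ,
    ENNReal.toReal_ofReal (net.availability_nonneg m)] at hb

end Uplink

end

end LEOUplink

theorem lemma4 {K : ℕ} (net : LEOUplink.Network K) (m : Fin K)
    (ν : Measure ℝ) [IsProbabilityMeasure ν]
    {Ω : Type*} [MeasurableSpace Ω] (μ : Measure Ω) [IsProbabilityMeasure μ]
    (S : LEOUplink.Uplink net m ν μ) :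
    ((∀ x, 0 ≤ x → cdf ν x = net.approxCDF x) → S.coverage = net.coverageFormula m) ∧
    (∀ ε : ℝ, (∀ x, 0 ≤ x → |cdf ν x - net.approxCDF x| ≤ ε) →
      |S.coverage - net.coverageFormula m| ≤ ε * net.availability m) ∧
    ((∀ x, 0 ≤ x → cdf ν x ≤ net.approxCDF x) → net.coverageFormula m ≤ S.coverage) ∧
    ((∀ x, 0 ≤ x → net.approxCDF x ≤ cdf ν x) → S.coverage ≤ net.coverageFormula m) ∧
    (net.m₁ = 1 → ν = gammaMeasure (net.m₁ : ℝ) (1 / net.m₂) →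
      S.coverage = net.coverageFormula m) := by
  refine ⟨fun h => ?_, fun ε h => S.abs_coverage_sub_le h, S.le_coverage_of_cdf_le,
    S.coverage_le_of_approxCDF_le, fun h1 hν => ?_⟩
  · exact le_antisymm (S.coverage_le_of_approxCDF_le fun x hx => (h x hx).ge)
      (S.le_coverage_of_cdf_le fun x hx => (h x hx).le)
  · have h : ∀ x, 0 ≤ x → cdf ν x = net.approxCDF x := fun x hx => by
      rw [hν, net.cdf_gammaMeasure_eq_approxCDF h1 hx]
    exact le_antisymm (S.coverage_le_of_approxCDF_le fun x hx => (h x hx).ge)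
      (S.le_coverage_of_cdf_le fun x hx => (h x hx).le)
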